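/- Identify $\mathbb{H}^n=\mathbb{R}^{4n}$ (with its Euclidean metric) with $\mathbb{C}^n\times\mathbb{C}^n$ by $(u,v)\mapsto u+v\mathbf{j}$, and let $\operatorname{Hopf}(q_1,\dots,q_n)=(\bar q_1\mathbf{i}q_1,\dots,\bar q_n\mathbf{i}q_n)$, where purely imaginary quaternions are identified with $\mathbb{R}^3$ and the plane $\mathbf{i}\oplus\mathbf{k}$ with $\mathbb{R}^2$. For $d\in\{2,3\}$ let $\operatorname{Arm}_d(n)$ be the space of lists $(e_1,\dots,e_n)$ of edge vectors in $\mathbb{R}^d$ with $\sum|e_i|=2$, and let $\operatorname{Pol}_d(n)\subset\operatorname{Arm}_d(n)$ be the subspace of closed polygons, those with $\sum e_i=0$. Each of these spaces carries the symmetric probability measure, the push-forward under $\operatorname{Hopf}$ of the normalized Riemannian volume of the following submanifold of $\mathbb{H}^n$: - for $\operatorname{Arm}_3(n)$: the sphere $S^{4n-1}$ of radius $\sqrt2$ in $\mathbb{H}^n$; - for $\operatorname{Pol}_3(n)$: the Stiefel manifold $V_2(\mathbb{C}^n)$ of Hermitian orthonormal frames $(u,v)$; - for $\operatorname{Arm}_2(n)$: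 the disjoint union $S^{2n-1}\sqcup S^{2n-1}$ of the spheres of radius $\sqrt2$ in $(1\oplus\mathbf{j})^n$ and in $(\mathbf{i}\oplus\mathbf{k})^n$; - for $\operatorname{Pol}_2(n)$: the disjoint union $V_2(\mathbb{R}^n)\sqcup\mathbf{i}V_2(\mathbb{R}^n)$. Let $\mathrm{B}$ be the Euler beta function. For every real $p>0$, every $n\ge1$ in the case of arms and every $n\ge2$ in the case of closed polygons, and every $1\le i\le n$, the $p$-th moments of the edgelength $|e_i|$ are $$E(|e_i|^p,\operatorname{Arm}_3(n))=2^p\,\frac{\mathrm{B}(p,2n)}{\mathrm{B}(p,2)},\qquad E(|e_i|^p,\operatorname{Pol}_3(n))=\frac{\mathrm{B}(p,n)}{\mathrm{B}(p,2)},$$ $$E(|e_i|^p,\operatorname{Arm}_2(n))=2^p\,\frac{\mathrm{B}(p,n)}{\mathrm{B}(p,1)},\qquad E(|e_i|^p,\operatorname{Pol}_2(n))=\frac{\mathrm{B}(p,n/2)}{\mathrm{B}(p,1)}.$$ In particular, the second moments are $$E(|e_i|^2,\operatorname{Arm}_3(n))=\frac{6}{n(n+\frac12)},\qquad E(|e_i|^2,\operatorname{Pol}_3(n))=\frac{6}{n(n+1)},$$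 $$E(|e_i|^2,\operatorname{Arm}_2(n))=\frac{8}{n(n+1)},\qquad E(|e_i|^2,\operatorname{Pol}_2(n))=\frac{8}{n(n+2)}.$$ -/

import Mathlib

open MeasureTheory
open scoped Quaternion

namespace PolygonSpace

noncomputable section

/-! ### The ambient quaternionic space -/

instance instMeasurableSpaceQuaternion : MeasurableSpace ℍ := borel ℍ

instance instBorelSpaceQuaternion : BorelSpace ℍ := ⟨rfl⟩

instance instSecondCountableQuaternion : SecondCountableTopology ℍ :=
  Quaternion.linearIsometryEquivTuple.toHomeomorph.secondCountableTopology

/-- The Euclidean space `ℍⁿ = ℝ⁴ⁿ`, with norm `(∑ |qᵢ|²)^(1/2)`. -/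
abbrev HSpace (n : ℕ) : Type := PiLp 2 (fun _ : Fin n => ℍ)

/-- The quaternion unit `𝐢`. -/
def qI : ℍ := ⟨0, 1, 0, 0⟩

/-- The quaternion unit `𝐣`. -/
def qJ : ℍ := ⟨0, 0, 1, 0⟩

/-! ### Polygon spaces -/

/-- `n`-edge polygonal arms of total length `2` in `ℝᵈ` up to translation, given by their lists of
edge vectors. -/
def Arm (d n : ℕ) : Set (Fin n → EuclideanSpace ℝ (Fin d)) :=
  {e | ∑ i, ‖e i‖ = 2}

/-- The arms that fail to close by the distance `ℓ`. -/
def ArmGap (d n : ℕ) (ℓ : ℝ) : Set (Fin n → EuclideanSpace ℝ (Fin d)) :=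
  {e | e ∈ Arm d n ∧ ‖∑ i, e i‖ = ℓ}

/-- Closed `n`-edge polygons of total length `2` in `ℝᵈ` up to translation. -/
def Pol (d n : ℕ) : Set (Fin n → EuclideanSpace ℝ (Fin d)) :=
  ArmGap d n 0

/-! ### The Hopf map -/

/-- The Hopf map `q ↦ q̄ 𝐢 q`; its value is a purely imaginary quaternion. -/
def hopf (q : ℍ) : ℍ := star q * qI * q

/-- The coordinatewise Hopf map into `ℝ³`, the purely imaginary quaternions with coordinates along
`𝐢, 𝐣, 𝐤`. -/
def hopf3 {n : ℕ} (q : HSpace n) : Fin n → EuclideanSpace ℝ (Fin 3) :=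
  fun i => !₂[(hopf (q i)).imI, (hopf (q i)).imJ, (hopf (q i)).imK]

/-- The coordinatewise Hopf map into `ℝ²`, the plane `𝐢 ⊕ 𝐤` with coordinates along `𝐢, 𝐤`. It is
used only on points all of whose Hopf images lie in this plane. -/
def hopf2 {n : ℕ} (q : HSpace n) : Fin n → EuclideanSpace ℝ (Fin 2) :=
  fun i => !₂[(hopf (q i)).imI, (hopf (q i)).imK]

/-! ### Model manifolds -/

/-- The sphere `S⁴ⁿ⁻¹` of radius `√2` in `ℍⁿ`. -/
def sphere3 (n : ℕ) : Set (HSpace n) := Metric.sphere 0 (Real.sqrt 2)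

/-- The two disjoint spheres `S²ⁿ⁻¹` of radius `√2` in `(1 ⊕ 𝐣)ⁿ` and in `(𝐢 ⊕ 𝐤)ⁿ`. -/
def spheres2 (n : ℕ) : Set (HSpace n) :=
  {q | q ∈ Metric.sphere 0 (Real.sqrt 2) ∧ ∀ i, (q i).imI = 0 ∧ (q i).imK = 0} ∪
  {q | q ∈ Metric.sphere 0 (Real.sqrt 2) ∧ ∀ i, (q i).re = 0 ∧ (q i).imJ = 0}

/-- The Stiefel manifold `V₂(ℂⁿ)` of Hermitian orthonormal frames `(u, v)`, embedded in `ℍⁿ`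
as `u + v 𝐣`. -/
def stiefelComplex (n : ℕ) : Set (HSpace n) :=
  {q | ∃ u v : EuclideanSpace ℂ (Fin n), Orthonormal ℂ ![u, v] ∧
    ∀ i, q i = (u i : ℍ) + (v i : ℍ) * qJ}

/-- The disjoint union of `V₂(ℝⁿ)`, embedded in `ℍⁿ` as `u + v 𝐣`, and of `𝐢 V₂(ℝⁿ)`. -/
def stiefelReal (n : ℕ) : Set (HSpace n) :=
  {q | ∃ u v : EuclideanSpace ℝ (Fin n), Orthonormal ℝ ![u, v] ∧
    ∀ i, q i = (u i : ℍ) + (v i : ℍ) * qJ} ∪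
  {q | ∃ u v : EuclideanSpace ℝ (Fin n), Orthonormal ℝ ![u, v] ∧
    ∀ i, q i = qI * ((u i : ℍ) + (v i : ℍ) * qJ)}

/-! ### The Hopf map takes the model manifolds to the polygon spaces -/

@[simp] lemma qI_re : qI.re = 0 := rfl
@[simp] lemma qI_imI : qI.imI = 1 := rfl
@[simp] lemma qI_imJ : qI.imJ = 0 := rfl
@[simp] lemma qI_imK : qI.imK = 0 := rfl
@[simp] lemma qJ_re : qJ.re = 0 := rfl
@[simp] lemma qJ_imI : qJ.imI = 0 := rfl
@[simp] lemma qJ_imJ : qJ.imJ = 1 := rfl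
@[simp] lemma qJ_imK : qJ.imK = 0 := rfl

lemma hopf_re (q : ℍ) : (hopf q).re = 0 := by
  simp [hopf]; ring

lemma hopf_imI (q : ℍ) : (hopf q).imI = q.re ^ 2 + q.imI ^ 2 - q.imJ ^ 2 - q.imK ^ 2 := by
  simp [hopf]; ring

lemma hopf_imJ (q : ℍ) : (hopf q).imJ = 2 * q.imI * q.imJ - 2 * q.re * q.imK := by
  simp [hopf]; ring

lemma hopf_imK (q : ℍ) : (hopf q).imK = 2 * q.re * q.imJ + 2 * q.imI * q.imK := by
  simp [hopf]; ring

lemma norm_sq_quaternion (q : ℍ) :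
    ‖q‖ ^ 2 = q.re ^ 2 + q.imI ^ 2 + q.imJ ^ 2 + q.imK ^ 2 := by
  rw [pow_two, ← Quaternion.normSq_eq_norm_mul_self, Quaternion.normSq_def']

lemma norm_hopf3 {n : ℕ} (q : HSpace n) (i : Fin n) : ‖hopf3 q i‖ = ‖q i‖ ^ 2 := by
  rw [EuclideanSpace.norm_eq, Real.sqrt_eq_iff_mul_self_eq (by positivity) (by positivity),
    norm_sq_quaternion]
  simp [hopf3, Fin.sum_univ_three, hopf_imI, hopf_imJ, hopf_imK]
  ring

lemma norm_hopf2 {n : ℕ} (q : HSpace n) (i : Fin n) (h : (hopf (q i)).imJ = 0) :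
    ‖hopf2 q i‖ = ‖q i‖ ^ 2 := by
  rw [← norm_hopf3, EuclideanSpace.norm_eq, EuclideanSpace.norm_eq]
  simp [hopf3, hopf2, Fin.sum_univ_three, h]

lemma sum_norm_sq_of_mem_sphere {n : ℕ} {q : HSpace n}
    (h : q ∈ Metric.sphere (0 : HSpace n) (Real.sqrt 2)) : ∑ i, ‖q i‖ ^ 2 = 2 := by
  rw [← PiLp.norm_sq_eq_of_L2]
  simp [mem_sphere_zero_iff_norm.1 h]

lemma mapsTo_sphere3 (n : ℕ) : Set.MapsTo hopf3 (sphere3 n) (Arm 3 n) := by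
  intro q hq
  simpa [Arm, norm_hopf3] using sum_norm_sq_of_mem_sphere hq

lemma mapsTo_spheres2 (n : ℕ) : Set.MapsTo hopf2 (spheres2 n) (Arm 2 n) := by
  rintro q (⟨hq, h⟩ | ⟨hq, h⟩)
  all_goals
    rw [Arm, Set.mem_ofPred_eq, ← sum_norm_sq_of_mem_sphere hq]
    refine Finset.sum_congr rfl fun i _ => norm_hopf2 q i ?_
    simp [hopf_imJ, h i]

lemma orthonormal_pair {𝕜 : Type*} [RCLike 𝕜] {n : ℕ} {u v : EuclideanSpace 𝕜 (Fin n)}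
    (h : Orthonormal 𝕜 ![u, v]) :
    ∑ i, ‖u i‖ ^ 2 = 1 ∧ ∑ i, ‖v i‖ ^ 2 = 1 ∧ ∑ i, v i * (starRingEnd 𝕜) (u i) = 0 := by
  have hu : ‖u‖ = 1 := h.1 0
  have hv : ‖v‖ = 1 := h.1 1
  have huv : inner 𝕜 u v = 0 := h.2 (show (0 : Fin 2) ≠ 1 by decide)
  refine ⟨?_, ?_, ?_⟩
  · rw [← EuclideanSpace.norm_sq_eq, hu, one_pow]
  · rw [← EuclideanSpace.norm_sq_eq, hv, one_pow]
  · simpa [PiLp.inner_apply] using huv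

lemma mapsTo_stiefelComplex (n : ℕ) : Set.MapsTo hopf3 (stiefelComplex n) (Pol 3 n) := by
  rintro q ⟨u, v, h, hq⟩
  obtain ⟨hu, hv, huv⟩ := orthonormal_pair h
  have huv1 := congrArg Complex.re huv
  have huv2 := congrArg Complex.im huv
  simp only [Complex.sq_norm, Complex.normSq_apply] at hu hv
  simp only [Complex.re_sum, Complex.im_sum, Complex.mul_re, Complex.mul_im, Complex.conj_re,
    Complex.conj_im, Complex.zero_re, Complex.zero_im] at huv1 huv2
  refine ⟨?_, ?_⟩
  · simp only [Arm, Set.mem_ofPred_eq, norm_hopf3, norm_sq_quaternion]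
    calc _ = ∑ i, ((u i).re * (u i).re + (u i).im * (u i).im) +
          ∑ i, ((v i).re * (v i).re + (v i).im * (v i).im) := by
          rw [← Finset.sum_add_distrib]
          refine Finset.sum_congr rfl fun i _ => ?_
          simp [hq]; ring
      _ = 2 := by rw [hu, hv]; norm_num
  · rw [norm_eq_zero]
    ext k
    fin_cases k
    · have : ∑ i, (hopf (q i)).imI = 0 := by
        calc _ = ∑ i, ((u i).re * (u i).re + (u i).im * (u i).im) -
              ∑ i, ((v i).re * (v i).re + (v i).im * (v i).im) := by
              rw [← Finset.sum_sub_distrib]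
              refine Finset.sum_congr rfl fun i _ => ?_
              simp [hopf_imI, hq]; ring
          _ = 0 := by rw [hu, hv]; norm_num
      simpa [hopf3] using this
    · have : ∑ i, (hopf (q i)).imJ = 0 := by
        refine Eq.trans ?_ ((congrArg (fun x : ℝ => -2 * x) huv2).trans (mul_zero _))
        rw [Finset.mul_sum]
        refine Finset.sum_congr rfl fun i _ => ?_
        simp [hopf_imJ, hq]; ring
      simpa [hopf3] using this
    · have : ∑ i, (hopf (q i)).imK = 0 := by
        refine Eq.trans ?_ ((congrArg (fun x : ℝ => 2 * x) huv1).trans (mul_zero _))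
        rw [Finset.mul_sum]
        refine Finset.sum_congr rfl fun i _ => ?_
        simp [hopf_imK, hq]; ring
      simpa [hopf3] using this

lemma mapsTo_stiefelReal (n : ℕ) : Set.MapsTo hopf2 (stiefelReal n) (Pol 2 n) := by
  rintro q (⟨u, v, h, hq⟩ | ⟨u, v, h, hq⟩)
  all_goals
    obtain ⟨hu, hv, huv⟩ := orthonormal_pair h
    simp only [Real.norm_eq_abs, sq_abs, conj_trivial] at hu hv huv
    refine ⟨?_, ?_⟩
    · have : ∑ i, ‖hopf2 q i‖ = ∑ i, u i ^ 2 + ∑ i, v i ^ 2 := by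
        rw [← Finset.sum_add_distrib]
        refine Finset.sum_congr rfl fun i _ => ?_
        rw [norm_hopf2 q i (by simp [hopf_imJ, hq]), norm_sq_quaternion]
        simp [hq]
      rw [Arm, Set.mem_ofPred_eq, this, hu, hv]; norm_num
    · rw [norm_eq_zero]
      ext k
      fin_cases k
      · have : ∑ i, (hopf (q i)).imI = 0 := by
          calc _ = ∑ i, u i ^ 2 - ∑ i, v i ^ 2 := by
                rw [← Finset.sum_sub_distrib]
                refine Finset.sum_congr rfl fun i _ => ?_
                simp [hopf_imI, hq]
            _ = 0 := by rw [hu, hv]; norm_num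
        simpa [hopf2] using this
      · have : ∑ i, (hopf (q i)).imK = 0 := by
          refine Eq.trans ?_ ((congrArg (fun x : ℝ => 2 * x) huv).trans (mul_zero _))
          rw [Finset.mul_sum]
          refine Finset.sum_congr rfl fun i _ => ?_
          simp [hopf_imK, hq]; ring
        simpa [hopf2] using this

/-! ### Symmetric measures -/

/-- The Riemannian volume of a `k`-dimensional submanifold `M` of the Euclidean space `ℍⁿ`, that is,
its `k`-dimensional Hausdorff measure, divided by the total volume of `M`. -/
def normalizedVolume {n : ℕ} (k : ℕ) (M : Set (HSpace n)) : Measure M :=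
  ((μHE[k] : Measure M) Set.univ)⁻¹ • (μHE[k] : Measure M)

/-- The symmetric measure on space arms: `μ(U) = Vol(Hopf⁻¹(U)) / Vol(S⁴ⁿ⁻¹)`. -/
def armMeasure3 (n : ℕ) : Measure (Arm 3 n) :=
  (normalizedVolume (4 * n - 1) (sphere3 n)).map ((mapsTo_sphere3 n).restrict hopf3 _ _)

/-- The symmetric measure on closed space polygons: `μ(U) = Vol(Hopf⁻¹(U)) / Vol(V₂(ℂⁿ))`, where
`V₂(ℂⁿ)` has dimension `4n - 4`. -/
def polMeasure3 (n : ℕ) : Measure (Pol 3 n) :=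
  (normalizedVolume (4 * n - 4) (stiefelComplex n)).map
    ((mapsTo_stiefelComplex n).restrict hopf3 _ _)

/-- The symmetric measure on plane arms: `μ(U) = Vol(Hopf⁻¹(U)) / Vol(S²ⁿ⁻¹ ⊔ S²ⁿ⁻¹)`. -/
def armMeasure2 (n : ℕ) : Measure (Arm 2 n) :=
  (normalizedVolume (2 * n - 1) (spheres2 n)).map ((mapsTo_spheres2 n).restrict hopf2 _ _)

/-- The symmetric measure on closed plane polygons:
`μ(U) = Vol(Hopf⁻¹(U)) / Vol(V₂(ℝⁿ) ⊔ 𝐢 V₂(ℝⁿ))`, where `V₂(ℝⁿ)` has dimension `2n - 3`. -/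
def polMeasure2 (n : ℕ) : Measure (Pol 2 n) :=
  (normalizedVolume (2 * n - 3) (stiefelReal n)).map ((mapsTo_stiefelReal n).restrict hopf2 _ _)

/-- The expectation of `|eᵢ|ᵖ` with respect to a measure on a space of lists of edges. -/
def edgeMoment {d n : ℕ} {P : Set (Fin n → EuclideanSpace ℝ (Fin d))} (μ : Measure P) (i : Fin n)
    (p : ℝ) : ℝ :=
  ∫ e : P, ‖(e : Fin n → EuclideanSpace ℝ (Fin d)) i‖ ^ p ∂μ

end

end PolygonSpace

/-! Since `‖hopf q‖ = ‖q‖ ^ 2`, the `p`-th moment of an edgelength is the `2p`-th moment of `‖q i‖`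
on the model manifold. In all four cases this is, up to the radius, the moment of the projection of
a uniform unit vector of `ℝ^N` to a subspace of dimension `k`, namely `projMoment N k (2 * p)`.

For spheres `q i` is such a projection. For Stiefel manifolds `q i` is row `i` of a random frame,
that is, two entries of row `i` of a Haar random unitary matrix. Inversion exchanges rows and
columns up to conjugation, so these are distributed like two coordinates of a uniform unit vector
(`lintegral_frame_orbit`).

The projection moment comes from evaluating the Gaussian integral of `‖T x‖ ^ q` twice: by splitting
off the subspace, and by averaging over a compact group transitive on the unit sphere
(`lintegral_norm_adjoint_orbit`). The quotient of Gamma values is a quotient of Beta values.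

Hausdorff measure is preserved by isometries, so the same averaging applies to each connected type
of model, without any uniqueness theorem for invariant measures on it. Normalizing requires positive
finite volume, which holds for compact regular level sets (`euclideanHausdorffMeasure_levelSet`). -/

namespace PolygonSpace

noncomputable section

/-! ### Invariant probability measures on compact groups -/

section Haar

variable {G : Type*} [Group G] [MeasurableSpace G]

/-- Integrate `f (g * h)` in both variables: left invariance in `h` leaves the integral against `ν`,
right invariance in `g` the one against `ν'`, and Tonelli equates them. -/
lemma eq_of_isMulLeftInvariant_of_isMulRightInvariant [MeasurableMul₂ G] (ν ν' : Measure G)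
    [IsProbabilityMeasure ν] [IsProbabilityMeasure ν'] [ν.IsMulLeftInvariant] [ν'.IsMulRightInvariant] : ν = ν' := by
  refine Measure.ext_of_lintegral _ fun f hf => ?_
  have h1 : ∫⁻ g, ∫⁻ h, f (g * h) ∂ν ∂ν' = ∫⁻ h, f h ∂ν := by
    simp [lintegral_mul_left_eq_self f]
  have h2 : ∫⁻ h, ∫⁻ g, f (g * h) ∂ν' ∂ν = ∫⁻ h, f h ∂ν' := by
    simp [lintegral_mul_right_eq_self f]
  rw [← h1, ← h2, lintegral_lintegral_swap]
  exact (hf.comp measurable_mul).aemeasurable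

/-- A compact group carries a bi-invariant and inversion invariant probability measure. -/
lemma exists_invariant_probability (G : Type*) [Group G] [TopologicalSpace G] [IsTopologicalGroup G]
    [CompactSpace G] [SecondCountableTopology G] [MeasurableSpace G] [BorelSpace G] :
    ∃ ν : Measure G, IsProbabilityMeasure ν ∧ ν.IsMulRightInvariant ∧ ν.IsInvInvariant := by
  let ν : Measure G := Measure.haarMeasure ⊤
  have hν : IsProbabilityMeasure ν := ⟨by
    simpa using Measure.haarMeasure_self (G := G) (K₀ := ⊤)⟩
  have hν' : IsProbabilityMeasure ν.inv :=
    Measure.isProbabilityMeasure_map measurable_inv.aemeasurable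
  -- Inversion turns left invariance into right invariance, so this equality yields both remaining
  -- invariances.
  have h : ν = ν.inv := eq_of_isMulLeftInvariant_of_isMulRightInvariant ν ν.inv
  refine ⟨ν, hν, ?_, ⟨h.symm⟩⟩
  rw [h]
  infer_instance

/-- Averaging a function over a group of measure preserving maps does not change its integral. -/
lemma lintegral_eq_lintegral_average {G X : Type*} [MeasurableSpace G] [MeasurableSpace X]
    {ν : Measure G}
    [IsProbabilityMeasure ν] {μ : Measure X} [SFinite μ] {ρ : G → X → X}
    (hρ : Measurable fun z : G × X => ρ z.1 z.2) (hμ : ∀ g, MeasurePreserving (ρ g) μ μ)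
    {F : X → ENNReal} (hF : Measurable F) :
    ∫⁻ x, F x ∂μ = ∫⁻ x, ∫⁻ g, F (ρ g x) ∂ν ∂μ := by
  rw [lintegral_lintegral_swap]
  · simp [fun g => (hμ g).lintegral_comp hF]
  · exact (hF.comp (hρ.comp measurable_swap)).aemeasurable

end Haar

/-! ### Gaussian integrals -/

section Gauss

variable {E : Type*} [NormedAddCommGroup E] [InnerProductSpace ℝ E] [FiniteDimensional ℝ E]
  [MeasurableSpace E] [BorelSpace E]

lemma lintegral_gaussian (E : Type*) [NormedAddCommGroup E] [InnerProductSpace ℝ E]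
    [FiniteDimensional ℝ E] [MeasurableSpace E] [BorelSpace E] :
    ∫⁻ x : E, ENNReal.ofReal (Real.exp (-‖x‖ ^ 2)) =
      ENNReal.ofReal (Real.sqrt Real.pi ^ Module.finrank ℝ E) := by
  have h := GaussianFourier.integral_rexp_neg_mul_sq_norm (V := E) one_pos
  have h' : (Real.pi / 1) ^ ((Module.finrank ℝ E : ℝ) / 2) =
      Real.sqrt Real.pi ^ Module.finrank ℝ E := by
    rw [Real.sqrt_eq_rpow, ← Real.rpow_mul_natCast Real.pi_pos.le, div_one]
    congr 1; ring
  rw [h'] at h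
  simp only [neg_mul, one_mul] at h
  rw [← h, ofReal_integral_eq_lintegral_ofReal]
  -- A nonintegrable function has Bochner integral `0`, but the value found is positive.
  · by_contra hc
    rw [integral_undef hc] at h
    have := Real.sqrt_pos.2 Real.pi_pos
    exact absurd h (by positivity)
  · exact Filter.Eventually.of_forall fun x => (Real.exp_pos _).le

/-- Polar coordinates reduce this to `N` times the volume of the unit ball times a one-dimensional
Gamma integral. -/
lemma lintegral_norm_rpow_mul_gaussian (E : Type*) [NormedAddCommGroup E] [InnerProductSpace ℝ E]
    [FiniteDimensional ℝ E] [MeasurableSpace E] [BorelSpace E] [Nontrivial E] {q : ℝ}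
    (hq : 0 ≤ q) :
    ∫⁻ x : E, ENNReal.ofReal (‖x‖ ^ q * Real.exp (-‖x‖ ^ 2)) =
      ENNReal.ofReal (Real.sqrt Real.pi ^ Module.finrank ℝ E *
        (Real.Gamma ((Module.finrank ℝ E + q) / 2) / Real.Gamma (Module.finrank ℝ E / 2))) := by
  set N := Module.finrank ℝ E with hN
  have hN0 : 0 < N := Module.finrank_pos
  have hNr : (0 : ℝ) < N := by exact_mod_cast hN0
  have hΓ : 0 < Real.Gamma (N / 2) := Real.Gamma_pos_of_pos (by positivity)
  have hΓ' : 0 < Real.Gamma ((N + q) / 2) := Real.Gamma_pos_of_pos (by positivity)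
  have hπ := Real.sqrt_pos.2 Real.pi_pos
  have h := integral_fun_norm_addHaar (volume : Measure E) fun y => y ^ q * Real.exp (-y ^ 2)
  have hball : (volume : Measure E).real (Metric.ball 0 1) =
      Real.sqrt Real.pi ^ N / Real.Gamma (N / 2 + 1) := by
    rw [Measure.real, InnerProductSpace.volume_ball, ENNReal.ofReal_one, one_pow, one_mul,
      ENNReal.toReal_ofReal]
    have := Real.Gamma_pos_of_pos (show (0 : ℝ) < (N : ℝ) / 2 + 1 by positivity)
    positivity
  have hint : ∫ y in Set.Ioi (0 : ℝ), y ^ (N - 1) • (y ^ q * Real.exp (-y ^ 2)) =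
      1 / 2 * Real.Gamma ((N + q) / 2) := by
    have := integral_rpow_mul_exp_neg_rpow (p := 2) (q := N - 1 + q) two_pos (by linarith)
    rw [show ((N : ℝ) - 1 + q + 1) / 2 = (N + q) / 2 by ring] at this
    rw [← this]
    refine setIntegral_congr_fun measurableSet_Ioi fun y hy => ?_
    have hy : 0 < y := hy
    simp only [smul_eq_mul]
    rw [Real.rpow_add hy, ← mul_assoc, Real.rpow_two, ← Real.rpow_natCast y (N - 1),
      Nat.cast_sub hN0, Nat.cast_one]
  rw [← hN, hball, hint, Real.Gamma_add_one (by positivity)] at h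
  have h2 : N • (Real.sqrt Real.pi ^ N / (N / 2 * Real.Gamma (N / 2))) •
      (1 / 2 * Real.Gamma ((N + q) / 2)) =
      Real.sqrt Real.pi ^ N * (Real.Gamma ((N + q) / 2) / Real.Gamma (N / 2)) := by
    simp only [nsmul_eq_mul, smul_eq_mul]
    field_simp
  rw [h2] at h
  rw [← h, ofReal_integral_eq_lintegral_ofReal]
  · by_contra hc
    rw [integral_undef hc] at h
    exact absurd h (by positivity)
  · exact Filter.Eventually.of_forall fun x => by positivity

/-- The coordinates of a Gaussian vector along a subspace are independent of the others. -/
lemma lintegral_norm_adjoint_rpow_mul_gaussian {W : Type*} [NormedAddCommGroup W]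
    [InnerProductSpace ℝ W] [FiniteDimensional ℝ W] [Nontrivial W] (S : W →ₗᵢ[ℝ] E) (T : E → W)
    (hT : ∀ w x, inner ℝ (S w) x = inner ℝ w (T x)) {q : ℝ} (hq : 0 ≤ q) :
    ∫⁻ x : E, ENNReal.ofReal (‖T x‖ ^ q * Real.exp (-‖x‖ ^ 2)) =
      ENNReal.ofReal (Real.sqrt Real.pi ^ Module.finrank ℝ E *
        (Real.Gamma ((Module.finrank ℝ W + q) / 2) / Real.Gamma (Module.finrank ℝ W / 2))) := by
  set K := LinearMap.range S.toLinearMap with hK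
  have hd : Module.finrank ℝ K = Module.finrank ℝ W :=
    LinearMap.finrank_range_of_inj S.injective
  have hd' : Module.finrank ℝ E = Module.finrank ℝ K + Module.finrank ℝ Kᗮ :=
    (Submodule.finrank_add_finrank_orthogonal K).symm
  have : Nontrivial K := Module.nontrivial_of_finrank_pos (R := ℝ) (by
    rw [hd]; exact Module.finrank_pos)
  let D := K.orthogonalDecomposition
  have hD : MeasurePreserving (fun x => WithLp.ofLp (D x)) volume volume :=
    (WithLp.volume_preserving_ofLp _ _).comp D.measurePreserving
  have hTx : ∀ x, ‖T x‖ = ‖(D x).fst‖ := by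
    intro x
    -- `T` is adjoint to the isometry `S`, so `S ∘ T` is the orthogonal projection to the range of
    -- `S`.
    have : K.starProjection x = S (T x) := by
      refine Submodule.eq_starProjection_of_mem_of_inner_eq_zero ⟨T x, rfl⟩ ?_
      rintro _ ⟨w, rfl⟩
      rw [real_inner_comm, inner_sub_right]
      simp [hT w x, S.inner_map_map]
    rw [← S.norm_map, ← this]
    simp [D]
  have hx : ∀ x, ‖x‖ ^ 2 = ‖(D x).fst‖ ^ 2 + ‖(D x).snd‖ ^ 2 := by
    intro x
    rw [← D.norm_map x, WithLp.prod_norm_sq_eq_of_L2]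
  let Φ : K × Kᗮ → ENNReal := fun z => ENNReal.ofReal (‖z.1‖ ^ q * Real.exp (-‖z.1‖ ^ 2)) *
    ENNReal.ofReal (Real.exp (-‖z.2‖ ^ 2))
  have hΦ : Measurable Φ := by fun_prop
  calc _ = ∫⁻ x : E, Φ (WithLp.ofLp (D x)) := by
        refine lintegral_congr fun x => ?_
        simp only [Φ]
        rw [← ENNReal.ofReal_mul (by positivity), hTx, hx, neg_add, Real.exp_add, mul_assoc]
        rfl
    _ = _ := by
        have hprod := lintegral_prod_mul (μ := (volume : Measure K)) (ν := (volume : Measure Kᗮ))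
          (f := fun z => ENNReal.ofReal (‖z‖ ^ q * Real.exp (-‖z‖ ^ 2)))
          (g := fun z => ENNReal.ofReal (Real.exp (-‖z‖ ^ 2))) (by fun_prop) (by fun_prop)
        rw [hD.lintegral_comp (f := Φ) hΦ, Measure.volume_eq_prod]
        refine hprod.trans ?_
        rw [lintegral_norm_rpow_mul_gaussian K hq, lintegral_gaussian, ← ENNReal.ofReal_mul, hd',
          pow_add, hd]
        · congr 1; ring
        · have := Real.Gamma_pos_of_pos (show (0 : ℝ) < (Module.finrank ℝ K + q) / 2 by
            have : 0 < Module.finrank ℝ K := Module.finrank_pos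
            positivity)
          have := Real.Gamma_pos_of_pos (show (0 : ℝ) < (Module.finrank ℝ K : ℝ) / 2 by
            have : 0 < Module.finrank ℝ K := Module.finrank_pos
            positivity)
          positivity

end Gauss

/-! ### Moments of projections on spheres -/

/-- The `q`-th moment of the norm of the projection of a uniform random vector of the unit sphere of
a Euclidean space of dimension `N` to a subspace of dimension `k`. -/
def projMoment (N k : ℕ) (q : ℝ) : ℝ :=
  Real.Gamma ((k + q) / 2) * Real.Gamma (N / 2) / (Real.Gamma (k / 2) * Real.Gamma ((N + q) / 2))

section Average

variable {E : Type*} [NormedAddCommGroup E] [InnerProductSpace ℝ E] [FiniteDimensional ℝ E]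
  [MeasurableSpace E] [BorelSpace E] [Nontrivial E]
  {W : Type*} [NormedAddCommGroup W] [InnerProductSpace ℝ W] [FiniteDimensional ℝ W] [Nontrivial W]
  {G : Type*} [Group G] [MeasurableSpace G] [MeasurableMul₂ G]

/-- The average of `‖T (g x)‖ ^ q` over a group acting transitively on the unit sphere. -/
lemma lintegral_norm_adjoint_orbit (ν : Measure G) [IsProbabilityMeasure ν]
    [ν.IsMulRightInvariant] (ρ : G →* (E ≃ₗᵢ[ℝ] E))
    (hρ : Measurable fun z : G × E => ρ z.1 z.2)
    (htr : ∀ x y : E, ‖x‖ = 1 → ‖y‖ = 1 → ∃ g, ρ g x = y)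
    (S : W →ₗᵢ[ℝ] E) (T : E →L[ℝ] W)
    (hT : ∀ w x, inner ℝ (S w) x = inner ℝ w (T x)) {q : ℝ} (hq : 0 < q) (x : E) :
    ∫⁻ g, ENNReal.ofReal (‖T (ρ g x)‖ ^ q) ∂ν =
      ENNReal.ofReal (‖x‖ ^ q * projMoment (Module.finrank ℝ E) (Module.finrank ℝ W) q) := by
  set A : E → ENNReal := fun x => ∫⁻ g, ENNReal.ofReal (‖T (ρ g x)‖ ^ q) ∂ν with hA
  obtain ⟨e, he⟩ : ∃ e : E, ‖e‖ = 1 := exists_norm_eq E zero_le_one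
  -- Transitivity moves `e` to `y` by a group element, which right invariance of `ν` absorbs.
  have hconst : ∀ y, ‖y‖ = 1 → A y = A e := by
    intro y hy
    obtain ⟨h, rfl⟩ := htr e y he hy
    have := lintegral_mul_right_eq_self (μ := ν) (fun g => ENNReal.ofReal (‖T (ρ g e)‖ ^ q)) h
    simpa [hA] using this
  -- Homogeneity of degree `q`; at `x = 0` both sides vanish because `q > 0`.
  have hsc : ∀ x, A x = ENNReal.ofReal (‖x‖ ^ q) * A e := by
    intro x
    rcases eq_or_ne x 0 with rfl | hx
    · simp [hA, Real.zero_rpow hq.ne']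
    · have hx' : 0 < ‖x‖ := norm_pos_iff.2 hx
      rw [← hconst (‖x‖⁻¹ • x) (by rw [norm_smul, norm_inv, norm_norm]; field_simp), hA]
      simp only
      rw [← lintegral_const_mul']
      · refine lintegral_congr fun g => ?_
        rw [← ENNReal.ofReal_mul (by positivity), map_smul, map_smul, norm_smul,
          Real.mul_rpow (by positivity) (by positivity), norm_inv, norm_norm, ← mul_assoc,
          Real.inv_rpow (by positivity), mul_inv_cancel₀ (by positivity), one_mul]
      · simp
  have hTm : Measurable fun x : E => ‖T x‖ := T.continuous.norm.measurable
  -- The Gaussian weight is invariant under the group, so averaging replaces `‖T x‖ ^ q` by `‖x‖ ^ q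
  -- * A e`; both integrals are known, which determines `A e`.
  have key : ∫⁻ x : E, ENNReal.ofReal (‖T x‖ ^ q * Real.exp (-‖x‖ ^ 2)) =
      (∫⁻ x : E, ENNReal.ofReal (‖x‖ ^ q * Real.exp (-‖x‖ ^ 2))) * A e := by
    rw [lintegral_eq_lintegral_average (ν := ν) hρ (fun g => (ρ g).measurePreserving)
      (by fun_prop), ← lintegral_mul_const _ (by fun_prop)]
    refine lintegral_congr fun x => ?_
    simp only [(ρ _).norm_map]
    rw [ENNReal.ofReal_mul (by positivity), mul_right_comm, ← hsc x, mul_comm, hA,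
      ← lintegral_const_mul' _ _ (by simp)]
    refine lintegral_congr fun g => ?_
    rw [← ENNReal.ofReal_mul (by positivity), mul_comm]
  rw [lintegral_norm_adjoint_rpow_mul_gaussian S T hT hq.le,
    lintegral_norm_rpow_mul_gaussian E hq.le] at key
  change A x = _
  have hN : (0 : ℝ) < Module.finrank ℝ E := by exact_mod_cast Module.finrank_pos
  have hk : (0 : ℝ) < Module.finrank ℝ W := by exact_mod_cast Module.finrank_pos
  have h1 := Real.Gamma_pos_of_pos (show (0 : ℝ) < Module.finrank ℝ E / 2 by positivity)
  have h2 := Real.Gamma_pos_of_pos (show (0 : ℝ) < (Module.finrank ℝ E + q) / 2 by positivity)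
  have h3 := Real.Gamma_pos_of_pos (show (0 : ℝ) < Module.finrank ℝ W / 2 by positivity)
  have h4 := Real.Gamma_pos_of_pos (show (0 : ℝ) < (Module.finrank ℝ W + q) / 2 by positivity)
  have hπ := Real.sqrt_pos.2 Real.pi_pos
  rw [hsc, ENNReal.ofReal_mul (by positivity)]
  congr 1
  have hpos : 0 < Real.sqrt Real.pi ^ Module.finrank ℝ E *
      (Real.Gamma ((Module.finrank ℝ E + q) / 2) / Real.Gamma (Module.finrank ℝ E / 2)) := by
    positivity
  refine (ENNReal.mul_right_inj (ENNReal.ofReal_pos.2 hpos).ne' ENNReal.ofReal_ne_top).1 ?_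
  rw [← key, ← ENNReal.ofReal_mul hpos.le, projMoment]
  congr 1
  field_simp

end Average

/-! ### Hausdorff measure of regular level sets -/

section LevelSet

open Filter Topology Module

variable {E F : Type*} [NormedAddCommGroup E] [NormedSpace ℝ E] [FiniteDimensional ℝ E]
  [MeasurableSpace E] [BorelSpace E] [NormedAddCommGroup F] [NormedSpace ℝ F]
  [FiniteDimensional ℝ F] {f : E → F} {f' : E →L[ℝ] F} {a : E}

/-- Near a regular point the implicit function parametrizes the level set by a small ball of the
kernel. It is Lipschitz there, so the image has finite measure. -/
lemma hausdorffMeasure_finiteAtFilter_levelSet (hf : HasStrictFDerivAt f f' a)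
    (hf' : f'.range = ⊤) :
    (μH[finrank ℝ f'.ker] : Measure E).FiniteAtFilter (𝓝[f ⁻¹' {f a}] a) := by
  have : CompleteSpace E := FiniteDimensional.complete ℝ E
  set g := hf.implicitFunction f f' hf' (f a) with hg
  obtain ⟨C, s, hs, hC⟩ := (hf.to_implicitFunction hf').exists_lipschitzOnWith
  obtain ⟨r, hr, hrs⟩ := Metric.mem_nhds_iff.1 hs
  set φ := hf.implicitToOpenPartialHomeomorph f f' hf' with hφ
  have hcont : Tendsto (fun x => (φ x).2) (𝓝 a) (𝓝 0) := by
    have h1 : ContinuousAt φ a :=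
      φ.continuousAt (hf.mem_implicitToOpenPartialHomeomorph_source hf')
    have h2 : Tendsto (fun x => (φ x).2) (𝓝 a) (𝓝 (φ a).2) := (continuous_snd.tendsto _).comp h1
    rwa [hφ, hf.implicitToOpenPartialHomeomorph_self hf'] at h2
  refine ⟨f ⁻¹' {f a} ∩ {x | hf.implicitFunction f f' hf' (f x) (φ x).2 = x ∧ (φ x).2 ∈ Metric.ball 0 r}, ?_, ?_⟩
  · refine inter_mem_nhdsWithin _ ?_
    exact (hf.eq_implicitFunction hf').and (hcont.eventually (Metric.ball_mem_nhds _ hr))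
  · have hsub : f ⁻¹' {f a} ∩ {x | hf.implicitFunction f f' hf' (f x) (φ x).2 = x ∧ (φ x).2 ∈ Metric.ball 0 r} ⊆
        g '' Metric.ball 0 r := by
      rintro x ⟨hx, h1, h2⟩
      rw [Set.mem_preimage, Set.mem_singleton_iff] at hx
      rw [hx] at h1
      exact ⟨_, h2, h1⟩
    refine (measure_mono hsub).trans_lt
      (((hC.mono hrs).hausdorffMeasure_image_le (Nat.cast_nonneg _)).trans_lt ?_)
    refine ENNReal.mul_lt_top (by simp) ?_
    exact Metric.isBounded_ball.measure_lt_top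

/-- A linear projection `p` to the kernel, composed with the implicit function, has the identity as
derivative. So `p` maps the level set onto a neighbourhood in the kernel, and a Lipschitz map cannot
do this to a null set. -/
lemma hausdorffMeasure_levelSet_pos (hf : HasStrictFDerivAt f f' a) (hf' : f'.range = ⊤) :
    0 < (μH[finrank ℝ f'.ker] : Measure E) (f ⁻¹' {f a}) := by
  have : CompleteSpace E := FiniteDimensional.complete ℝ E
  set g := hf.implicitFunction f f' hf' (f a) with hg
  obtain ⟨p, hp⟩ := f'.ker_closedComplemented_of_finiteDimensional_range
  have hd : HasStrictFDerivAt (fun y => p (g y)) (p ∘L f'.ker.subtypeL) 0 :=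
    p.hasStrictFDerivAt.comp 0 (hf.to_implicitFunction hf')
  have hid : p ∘L f'.ker.subtypeL = ContinuousLinearMap.id ℝ f'.ker := by
    ext1 x; exact hp x
  have hmap := hd.map_nhds_eq_of_surj (by rw [hid]; exact LinearMap.range_id)
  have hev : ∀ᶠ y in 𝓝 (0 : f'.ker), g y ∈ f ⁻¹' {f a} := by
    have h : Tendsto (fun y : f'.ker => (f a, y)) (𝓝 0) (𝓝 (f a, 0)) :=
      (Continuous.prodMk_right (f a)).tendsto 0
    exact h.eventually (hf.map_implicitFunction_eq hf')
  have himg : p '' (f ⁻¹' {f a}) ∈ 𝓝 (p (g 0)) := by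
    rw [← hmap]
    exact hev.mono fun y hy => ⟨g y, hy, rfl⟩
  have hpos : 0 < (μH[finrank ℝ f'.ker] : Measure f'.ker) (p '' (f ⁻¹' {f a})) :=
    Measure.measure_pos_of_mem_nhds _ himg
  have hle := p.lipschitz.hausdorffMeasure_image_le (d := finrank ℝ f'.ker) (Nat.cast_nonneg _)
    (f ⁻¹' {f a})
  by_contra h0
  rw [not_lt, nonpos_iff_eq_zero] at h0
  rw [h0, mul_zero] at hle
  exact hpos.not_ge hle

/-- A compact level set consisting of regular points has positive and finite volume. -/
lemma euclideanHausdorffMeasure_levelSet {M : Set E} {b : F} (hM : M = f ⁻¹' {b})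
    (hc : IsCompact M) (hne : M.Nonempty) (k : ℕ) (hk : k + finrank ℝ F = finrank ℝ E)
    (hf : ∀ x ∈ M, ∃ f' : E →L[ℝ] F, HasStrictFDerivAt f f' x ∧ f'.range = ⊤) :
    (μHE[k] : Measure E) M ≠ 0 ∧ (μHE[k] : Measure E) M ≠ ⊤ := by
  have hker : ∀ f' : E →L[ℝ] F, f'.range = ⊤ → finrank ℝ f'.ker = k := by
    intro f' h
    have := LinearMap.finrank_range_add_finrank_ker f'.toLinearMap
    rw [h, finrank_top] at this
    omega
  -- `μHE[k]` is `μH[k]` times a finite nonzero constant, so both claims may be checked for `μH[k]`.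
  have hc0 := Measure.addHaarScalarFactor_volume_hausdorffMeasure_ne_zero k
  rw [Measure.euclideanHausdorffMeasure_def, Measure.smul_apply]
  have h1 : (μH[k] : Measure E) M ≠ 0 := by
    obtain ⟨x, hx⟩ := hne
    obtain ⟨f', h, h'⟩ := hf x hx
    have hb : f x = b := by rw [hM] at hx; exact hx
    have := hausdorffMeasure_levelSet_pos h h'
    rw [hker f' h', hb, ← hM] at this
    exact this.ne'
  have h2 : (μH[k] : Measure E) M ≠ ⊤ := by
    refine (hc.measure_lt_top_of_nhdsWithin fun x hx => ?_).ne
    obtain ⟨f', h, h'⟩ := hf x hx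
    have hb : f x = b := by rw [hM] at hx; exact hx
    have := hausdorffMeasure_finiteAtFilter_levelSet h h'
    rwa [hker f' h', hb, ← hM] at this
  refine ⟨?_, ?_⟩
  · simp [ENNReal.smul_def, h1, hc0]
  · rw [ENNReal.smul_def]
    exact ENNReal.mul_ne_top (by simp) h2

end LevelSet

/-! ### The unitary group -/

section Unitary

variable {𝕜 ι : Type*} [RCLike 𝕜] [Fintype ι] [DecidableEq ι]

instance instCompactSpaceUnitaryGroup : CompactSpace (Matrix.unitaryGroup ι 𝕜) := by
  have hcl : IsClosed (Matrix.unitaryGroup ι 𝕜 : Set (Matrix ι ι 𝕜)) := by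
    have : (Matrix.unitaryGroup ι 𝕜 : Set (Matrix ι ι 𝕜)) = {A | A * star A = 1} := by
      ext A; exact Matrix.mem_unitaryGroup_iff
    rw [this]
    exact isClosed_eq (by fun_prop) continuous_const
  have hK : IsCompact {A : Matrix ι ι 𝕜 | ∀ i, A i ∈ {B : ι → 𝕜 | ∀ j, B j ∈ Metric.closedBall 0 1}} :=
    isCompact_pi_infinite fun _ => isCompact_pi_infinite fun _ =>
      isCompact_closedBall (0 : 𝕜) 1
  refine isCompact_iff_compactSpace.1 (hK.of_isClosed_subset hcl fun A hA i j => ?_)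
  simpa using entry_norm_bound_of_unitary hA i j

instance instSecondCountableUnitaryGroup :
    SecondCountableTopology (Matrix.unitaryGroup ι 𝕜) :=
  have : SecondCountableTopology (Matrix ι ι 𝕜) :=
    inferInstanceAs (SecondCountableTopology (ι → ι → 𝕜))
  TopologicalSpace.Subtype.secondCountableTopology _

/-- Unitary matrices as isometries. -/
def unitaryIsometry : Matrix.unitaryGroup ι 𝕜 ≃* (EuclideanSpace 𝕜 ι ≃ₗᵢ[𝕜] EuclideanSpace 𝕜 ι) :=
  (Unitary.mapEquiv ⟨((Matrix.toEuclideanCLM (𝕜 := 𝕜) (n := ι)) : _ ≃* _),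
    map_star (Matrix.toEuclideanCLM (𝕜 := 𝕜) (n := ι))⟩).toMulEquiv.trans
    Unitary.linearIsometryEquiv

lemma unitaryIsometry_apply (g : Matrix.unitaryGroup ι 𝕜) (x : EuclideanSpace 𝕜 ι) :
    unitaryIsometry g x = WithLp.toLp 2 ((g : Matrix ι ι 𝕜).mulVec x.ofLp) := by
  rfl

attribute [irreducible] unitaryIsometry

lemma continuous_unitaryIsometry :
    Continuous fun z : Matrix.unitaryGroup ι 𝕜 × EuclideanSpace 𝕜 ι =>
      unitaryIsometry z.1 z.2 := by
  simp only [unitaryIsometry_apply]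
  fun_prop

lemma unitaryIsometry_single_apply (g : Matrix.unitaryGroup ι 𝕜) (i j : ι) :
    unitaryIsometry g (EuclideanSpace.single i 1) j = (g : Matrix ι ι 𝕜) j i := by
  simp [unitaryIsometry_apply]

/-- Extend the family to an orthonormal basis and take the change of basis. -/
lemma exists_unitaryIsometry_eq {v : ι → EuclideanSpace 𝕜 ι} {s : Set ι}
    (hv : Orthonormal 𝕜 (s.domRestrict v)) :
    ∃ g : Matrix.unitaryGroup ι 𝕜, ∀ i ∈ s,
      unitaryIsometry g (EuclideanSpace.single i 1) = v i := by
  obtain ⟨b, hb⟩ := hv.exists_orthonormalBasis_extension_of_card_eq (by simp)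
  refine ⟨unitaryIsometry.symm b.repr.symm, fun i hi => ?_⟩
  rw [MulEquiv.apply_symm_apply, ← hb i hi]
  simp

lemma exists_unitaryIsometry_eq_of_norm_eq_one {x : EuclideanSpace 𝕜 ι} (hx : ‖x‖ = 1) (i : ι) :
    ∃ g : Matrix.unitaryGroup ι 𝕜, unitaryIsometry g (EuclideanSpace.single i 1) = x := by
  obtain ⟨g, hg⟩ := exists_unitaryIsometry_eq (v := fun _ => x) (s := {i}) (𝕜 := 𝕜)
    ⟨fun _ => hx, fun a b hab => absurd (Subsingleton.elim a b) hab⟩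
  exact ⟨g, hg i rfl⟩

lemma exists_unitaryIsometry_map {x y : EuclideanSpace 𝕜 ι} (hx : ‖x‖ = 1) (hy : ‖y‖ = 1) :
    ∃ g : Matrix.unitaryGroup ι 𝕜, unitaryIsometry g x = y := by
  have : Nonempty ι := by
    by_contra h
    rw [not_nonempty_iff] at h
    simp [Subsingleton.elim x 0] at hx
  obtain ⟨i⟩ := this
  obtain ⟨g, rfl⟩ := exists_unitaryIsometry_eq_of_norm_eq_one hx i
  obtain ⟨h, rfl⟩ := exists_unitaryIsometry_eq_of_norm_eq_one hy i
  exact ⟨h * g⁻¹, by simp [map_mul, map_inv]⟩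

lemma exists_unitaryIsometry_pair {u v : EuclideanSpace 𝕜 ι} (h : Orthonormal 𝕜 ![u, v])
    {a b : ι} (hab : a ≠ b) : ∃ g : Matrix.unitaryGroup ι 𝕜,
      unitaryIsometry g (EuclideanSpace.single a 1) = u ∧
      unitaryIsometry g (EuclideanSpace.single b 1) = v := by
  -- Values outside `{a, b}` are irrelevant; on it the family is `![u, v]` reindexed along an
  -- injection.
  obtain ⟨g, hg⟩ := exists_unitaryIsometry_eq (v := fun i => if i = a then u else v) (s := {a, b})
    (𝕜 := 𝕜) (by
      let t : ({a, b} : Set ι) → Fin 2 := fun i => if i = a then 0 else 1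
      have ht : Function.Injective t := by
        rintro ⟨i, rfl | rfl⟩ ⟨j, rfl | rfl⟩ <;> simp [t, hab.symm]
      convert h.comp t ht using 1
      ext1 ⟨i, rfl | rfl⟩ <;> simp [t, hab.symm])
  refine ⟨g, ?_, ?_⟩
  · simpa using hg a (by simp)
  · simpa [hab.symm] using hg b (by simp)

end Unitary

/-! ### Spheres -/

section Sphere

variable {E W : Type*} [NormedAddCommGroup E] [InnerProductSpace ℝ E] [FiniteDimensional ℝ E]
  [MeasurableSpace E] [BorelSpace E] [Nontrivial E]
  [NormedAddCommGroup W] [InnerProductSpace ℝ W] [FiniteDimensional ℝ W] [Nontrivial W]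

/-- Averaging over the orthogonal group turns the integrand into a function of `‖x‖` alone, which is
almost everywhere constant. -/
lemma lintegral_norm_adjoint_of_invariant {μ : Measure E} [IsFiniteMeasure μ]
    (hμ : ∀ g : E ≃ₗᵢ[ℝ] E, MeasurePreserving g μ μ) {r : ℝ} (hr : ∀ᵐ x ∂μ, ‖x‖ = r)
    (S : W →ₗᵢ[ℝ] E) (T : E →L[ℝ] W)
    (hT : ∀ w x, inner ℝ (S w) x = inner ℝ w (T x)) {q : ℝ} (hq : 0 < q) :
    ∫⁻ x, ENNReal.ofReal (‖T x‖ ^ q) ∂μ =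
      ENNReal.ofReal (r ^ q * projMoment (Module.finrank ℝ E) (Module.finrank ℝ W) q) *
        μ Set.univ := by
  let ι := Fin (Module.finrank ℝ E)
  let G := Matrix.unitaryGroup ι ℝ
  borelize ↥G
  obtain ⟨ν, hν, hν', -⟩ := exists_invariant_probability ↥G
  obtain ⟨b⟩ : Nonempty (E ≃ₗᵢ[ℝ] EuclideanSpace ℝ ι) := ⟨(stdOrthonormalBasis ℝ E).repr⟩
  let ρ : ↥G →* (E ≃ₗᵢ[ℝ] E) :=
    { toFun := fun g => (b.trans (unitaryIsometry g)).trans b.symm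
      map_one' := by ext x; simp
      map_mul' := fun g h => by ext x; simp }
  have hρ : Measurable fun z : ↥G × E => ρ z.1 z.2 := by
    have h1 : Continuous fun z : ↥G × E => (z.1, b z.2) := by fun_prop
    exact (b.symm.continuous.comp (continuous_unitaryIsometry.comp h1)).measurable
  have htr : ∀ x y : E, ‖x‖ = 1 → ‖y‖ = 1 → ∃ g, ρ g x = y := by
    intro x y hx hy
    obtain ⟨g, hg⟩ := exists_unitaryIsometry_map (x := b x) (y := b y) ((b.norm_map x).trans hx)
      ((b.norm_map y).trans hy)
    exact ⟨g, by simp [ρ, hg]⟩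
  rw [lintegral_eq_lintegral_average (ν := ν) hρ (fun g => hμ (ρ g))
    (by have := T.continuous.norm.measurable; fun_prop)]
  simp only [lintegral_norm_adjoint_orbit ν ρ hρ htr S T hT hq]
  rw [← lintegral_const]
  refine lintegral_congr_ae (hr.mono fun x hx => ?_)
  simp only [hx]

/-- The moments of the norm of a projection with respect to the volume of a sphere. -/
lemma sphere_lintegral_norm_adjoint {r : ℝ} (hr : 0 < r) (S : W →ₗᵢ[ℝ] E) (T : E →L[ℝ] W)
    (hT : ∀ w x, inner ℝ (S w) x = inner ℝ w (T x)) {q : ℝ} (hq : 0 < q) {k : ℕ}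
    (hk : k + 1 = Module.finrank ℝ E) :
    (μHE[k] : Measure E) (Metric.sphere 0 r) ≠ 0 ∧ (μHE[k] : Measure E) (Metric.sphere 0 r) ≠ ⊤ ∧
    ∫⁻ x in Metric.sphere 0 r, ENNReal.ofReal (‖T x‖ ^ q) ∂μHE[k] =
      ENNReal.ofReal (r ^ q * projMoment (Module.finrank ℝ E) (Module.finrank ℝ W) q) *
        μHE[k] (Metric.sphere (0 : E) r) := by
  obtain ⟨h0, h1⟩ := euclideanHausdorffMeasure_levelSet (M := Metric.sphere (0 : E) r)
    (f := fun x => ‖x‖ ^ 2) (b := r ^ 2)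
    (by ext x; simp [pow_left_inj₀ (norm_nonneg x) hr.le two_ne_zero])
    (isCompact_sphere 0 r) (NormedSpace.sphere_nonempty.2 hr.le) k (by simpa using hk)
    (by
      intro x hx
      refine ⟨_, hasStrictFDerivAt_norm_sq x, ?_⟩
      rw [LinearMap.range_eq_top]
      intro c
      have hx' : ‖x‖ = r := by simpa using hx
      -- The derivative at `x` is `2 ⟨x, ·⟩`, and `⟨x, x⟩ = r ^ 2`.
      refine ⟨(c / (2 * r ^ 2)) • x, ?_⟩
      simp [hx']
      field_simp)
  refine ⟨h0, h1, ?_⟩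
  have hfin : IsFiniteMeasure ((μHE[k] : Measure E).restrict (Metric.sphere 0 r)) :=
    ⟨by simpa using h1.lt_top⟩
  rw [lintegral_norm_adjoint_of_invariant (μ := (μHE[k] : Measure E).restrict (Metric.sphere 0 r))
    ?_ (r := r) ?_ S T hT hq]
  · simp
  · intro g
    have := (g.toIsometryEquiv.measurePreserving_euclideanHausdorffMeasure k).restrict_preimage
      (s := Metric.sphere 0 r) Metric.isClosed_sphere.measurableSet
    have hs : g.toIsometryEquiv ⁻¹' Metric.sphere 0 r = Metric.sphere 0 r := by
      ext x; simp
    rw [hs] at this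
    exact this
  · filter_upwards [ae_restrict_mem Metric.isClosed_sphere.measurableSet] with x hx
    simpa using hx

end Sphere

/-! ### Orbit averages over real or complex scalars -/

section Orbit

variable {𝕜 : Type*} [RCLike 𝕜] {V : Type*} [NormedAddCommGroup V] [InnerProductSpace 𝕜 V]
  [FiniteDimensional 𝕜 V] [MeasurableSpace V] [BorelSpace V] [Nontrivial V]
  {W : Type*} [NormedAddCommGroup W] [InnerProductSpace 𝕜 W] [FiniteDimensional 𝕜 W] [Nontrivial W]
  {G : Type*} [Group G] [MeasurableSpace G] [MeasurableMul₂ G]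

/-- `lintegral_norm_adjoint_orbit` for a group of unitary transformations. -/
lemma lintegral_norm_adjoint_unitary_orbit (ν : Measure G) [IsProbabilityMeasure ν]
    [ν.IsMulRightInvariant] (ρ : G →* (V ≃ₗᵢ[𝕜] V))
    (hρ : Measurable fun z : G × V => ρ z.1 z.2)
    (htr : ∀ x y : V, ‖x‖ = 1 → ‖y‖ = 1 → ∃ g, ρ g x = y)
    (S : W →ₗᵢ[𝕜] V) (T : V →L[𝕜] W)
    (hT : ∀ w x, inner 𝕜 (S w) x = inner 𝕜 w (T x)) {q : ℝ} (hq : 0 < q) (x : V) :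
    ∫⁻ g, ENNReal.ofReal (‖T (ρ g x)‖ ^ q) ∂ν =
      ENNReal.ofReal (‖x‖ ^ q * projMoment (Module.finrank ℝ 𝕜 * Module.finrank 𝕜 V)
        (Module.finrank ℝ 𝕜 * Module.finrank 𝕜 W) q) := by
  -- Restricting scalars, with the real part as inner product, keeps all norms and hence
  -- transitivity on the unit sphere.
  let : InnerProductSpace ℝ V := InnerProductSpace.rclikeToReal 𝕜 V
  let : InnerProductSpace ℝ W := InnerProductSpace.rclikeToReal 𝕜 W
  have hV : IsScalarTower ℝ 𝕜 V := inferInstance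
  have hW : IsScalarTower ℝ 𝕜 W := inferInstance
  have : FiniteDimensional ℝ V := FiniteDimensional.trans ℝ 𝕜 V
  have : FiniteDimensional ℝ W := FiniteDimensional.trans ℝ 𝕜 W
  let ρ' : G →* (V ≃ₗᵢ[ℝ] V) :=
    { toFun := fun g =>
        { toLinearEquiv := (ρ g).toLinearEquiv.restrictScalars ℝ
          norm_map' := (ρ g).norm_map }
      map_one' := by ext x; simp
      map_mul' := fun g h => by ext x; simp; rfl }
  let S' : W →ₗᵢ[ℝ] V :=
    { toLinearMap := S.toLinearMap.restrictScalars ℝ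
      norm_map' := S.norm_map }
  rw [Module.finrank_mul_finrank, Module.finrank_mul_finrank]
  refine lintegral_norm_adjoint_orbit ν ρ' hρ htr S' (T.restrictScalars ℝ) (fun w x => ?_) hq x
  exact congrArg RCLike.re (hT w x)

end Orbit

/-! ### Stiefel manifolds -/

section Stiefel

variable {𝕜 ι : Type*} [RCLike 𝕜] [Fintype ι] [DecidableEq ι]

lemma orthonormal_pair_iff {V : Type*} [NormedAddCommGroup V] [InnerProductSpace 𝕜 V] {u v : V} :
    Orthonormal 𝕜 ![u, v] ↔ ‖u‖ = 1 ∧ ‖v‖ = 1 ∧ inner 𝕜 u v = 0 := by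
  constructor
  · intro h
    exact ⟨h.1 0, h.1 1, h.2 (show (0 : Fin 2) ≠ 1 by decide)⟩
  · rintro ⟨hu, hv, huv⟩
    refine ⟨fun i => by fin_cases i <;> simp [hu, hv], fun i j hij => ?_⟩
    fin_cases i <;> fin_cases j <;> simp_all [inner_eq_zero_symm]

/-- Every frame is a pair of basis vectors moved by some `A`, so the integrand involves entries `(i,
a)` and `(i, b)` of `g * A`. Invariance under translation and inversion replaces them by coordinates
`a` and `b` of `g` applied to the `i`-th basis vector, a projection of a point of a sphere orbit. -/
lemma lintegral_frame_orbit [MeasurableSpace (Matrix.unitaryGroup ι 𝕜)]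
    [BorelSpace (Matrix.unitaryGroup ι 𝕜)]
    (ν : Measure (Matrix.unitaryGroup ι 𝕜)) [IsProbabilityMeasure ν]
    [ν.IsMulRightInvariant] [ν.IsInvInvariant] (hι : 2 ≤ Fintype.card ι)
    {u v : EuclideanSpace 𝕜 ι} (h : Orthonormal 𝕜 ![u, v]) (i : ι) {p : ℝ} (hp : 0 < p) :
    ∫⁻ g, ENNReal.ofReal ((‖unitaryIsometry g u i‖ ^ 2 +
        ‖unitaryIsometry g v i‖ ^ 2) ^ p) ∂ν =
      ENNReal.ofReal (projMoment (Module.finrank ℝ 𝕜 * Fintype.card ι)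
        (Module.finrank ℝ 𝕜 * 2) (2 * p)) := by
  obtain ⟨a, b, hab⟩ := Fintype.one_lt_card_iff.1 hι
  have : Nonempty ι := ⟨a⟩
  borelize (EuclideanSpace 𝕜 ι)
  obtain ⟨A, rfl, rfl⟩ := exists_unitaryIsometry_pair h hab
  have hin : ∀ (j : ι) (x : EuclideanSpace 𝕜 ι), inner 𝕜 (EuclideanSpace.single j (1 : 𝕜)) x = x j :=
    fun j x => by rw [EuclideanSpace.inner_single_left]; simp
  have hS : ∃ S : EuclideanSpace 𝕜 (Fin 2) →ₗᵢ[𝕜] EuclideanSpace 𝕜 ι, ∀ w,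
      S w = w 0 • EuclideanSpace.single a 1 + w 1 • EuclideanSpace.single b 1 :=
    ⟨LinearMap.isometryOfInner
      { toFun := fun w => w 0 • EuclideanSpace.single a 1 + w 1 • EuclideanSpace.single b 1
        map_add' := fun w w' => by simp only [PiLp.add_apply, add_smul]; abel
        map_smul' := fun c w => by simp [mul_smul] }
      (fun w w' => by
        simp only [LinearMap.coe_mk, AddHom.coe_mk, inner_add_left, inner_add_right,
          inner_smul_left, inner_smul_right, hin]
        simp [hab, hab.symm, PiLp.inner_apply, Fin.sum_univ_two, mul_comm]), fun w => rfl⟩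
  obtain ⟨S, hS⟩ := hS
  let T : EuclideanSpace 𝕜 ι →L[𝕜] EuclideanSpace 𝕜 (Fin 2) :=
    LinearMap.toContinuousLinearMap
      { toFun := fun x => !₂[x a, x b]
        map_add' := fun x y => by ext k; fin_cases k <;> simp
        map_smul' := fun c x => by ext k; fin_cases k <;> simp }
  have hT : ∀ w x, inner 𝕜 (S w) x = inner 𝕜 w (T x) := by
    intro w x
    simp only [hS, inner_add_left, inner_smul_left, hin]
    simp [T, PiLp.inner_apply, Fin.sum_univ_two, mul_comm]
  have hnorm : ∀ x, ‖T x‖ ^ (2 * p) = (‖x a‖ ^ 2 + ‖x b‖ ^ 2) ^ p := by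
    intro x
    rw [Real.rpow_mul (norm_nonneg _), Real.rpow_two, EuclideanSpace.norm_sq_eq]
    simp [T, Fin.sum_univ_two]
  have key := lintegral_norm_adjoint_unitary_orbit ν (unitaryIsometry (𝕜 := 𝕜) (ι := ι)).toMonoidHom
    continuous_unitaryIsometry.measurable (fun x y hx hy => exists_unitaryIsometry_map hx hy)
    S T hT (mul_pos two_pos hp) (EuclideanSpace.single i 1)
  simp only [hnorm] at key
  simp only [finrank_euclideanSpace, Fintype.card_fin, PiLp.norm_single, norm_one,
    Real.one_rpow, one_mul] at key
  rw [← key]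
  let F : Matrix.unitaryGroup ι 𝕜 → ENNReal := fun g => ENNReal.ofReal ((‖(g : Matrix ι ι 𝕜) i a‖ ^ 2 +
    ‖(g : Matrix ι ι 𝕜) i b‖ ^ 2) ^ p)
  calc _ = ∫⁻ g, F (g * A) ∂ν := by
        refine lintegral_congr fun g => ?_
        simp only [F, ← unitaryIsometry_single_apply, map_mul, LinearIsometryEquiv.coe_mul,
          Function.comp_apply]
    -- Right invariance removes `A`; inversion invariance then allows `g⁻¹`.
    _ = ∫⁻ g, F g⁻¹ ∂ν := by
        rw [lintegral_mul_right_eq_self, lintegral_inv_eq_self]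
    _ = _ := by
        refine lintegral_congr fun g => ?_
        -- The inverse is the conjugate transpose, so row `i` of `g⁻¹` has the absolute values of
        -- column `i` of `g`.
        have hinv : ∀ j, ‖((g⁻¹ : Matrix.unitaryGroup ι 𝕜) : Matrix ι ι 𝕜) i j‖ =
            ‖(g : Matrix ι ι 𝕜) j i‖ := by
          intro j
          rw [Matrix.UnitaryGroup.inv_apply]
          simp [Matrix.star_apply]
        simp only [F, hinv]
        simp [unitaryIsometry_single_apply]

lemma isCompact_orthonormalPairs (𝕜 V : Type*) [RCLike 𝕜] [NormedAddCommGroup V]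
    [InnerProductSpace 𝕜 V] [NormedSpace ℝ V]
    [FiniteDimensional ℝ V] :
    IsCompact {x : WithLp 2 (V × V) | Orthonormal 𝕜 ![x.fst, x.snd]} := by
  have : ProperSpace (WithLp 2 (V × V)) := FiniteDimensional.proper ℝ _
  refine (isCompact_closedBall (0 : WithLp 2 (V × V)) 2).of_isClosed_subset ?_ ?_
  · simp only [orthonormal_pair_iff]
    have h1 : Continuous fun x : WithLp 2 (V × V) => x.fst := by fun_prop
    have h2 : Continuous fun x : WithLp 2 (V × V) => x.snd := by fun_prop
    exact (isClosed_eq h1.norm continuous_const).inter ((isClosed_eq h2.norm continuous_const).inter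
      (isClosed_eq (h1.inner h2) continuous_const))
  · intro x hx
    obtain ⟨hu, hv, -⟩ := orthonormal_pair_iff.1 hx
    rw [mem_closedBall_zero_iff]
    refine abs_le_of_sq_le_sq' ?_ two_pos.le |>.2
    rw [WithLp.prod_norm_sq_eq_of_L2, hu, hv]; norm_num

/-- The frames form a regular level set of the two squared norms and the inner product, of real
codimension `2 + finrank ℝ 𝕜`. -/
lemma orthonormalPairs_volume {V : Type*} [NormedAddCommGroup V] [InnerProductSpace 𝕜 V]
    [NormedSpace ℝ V]
    [FiniteDimensional ℝ V] [MeasurableSpace (WithLp 2 (V × V))] [BorelSpace (WithLp 2 (V × V))]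
    (hne : ∃ u v : V, Orthonormal 𝕜 ![u, v])
    {k : ℕ} (hk : k + (2 + Module.finrank ℝ 𝕜) = 2 * Module.finrank ℝ V) :
    (μHE[k] : Measure (WithLp 2 (V × V))) {x | Orthonormal 𝕜 ![x.fst, x.snd]} ≠ 0 ∧
    (μHE[k] : Measure (WithLp 2 (V × V))) {x | Orthonormal 𝕜 ![x.fst, x.snd]} ≠ ⊤ := by
  refine euclideanHausdorffMeasure_levelSet (F := ℝ × ℝ × 𝕜)
    (f := fun x => (RCLike.re (inner 𝕜 x.fst x.fst), RCLike.re (inner 𝕜 x.snd x.snd),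
      inner 𝕜 x.fst x.snd)) (b := (1, 1, 0)) ?_ (isCompact_orthonormalPairs 𝕜 V) ?_ k ?_ ?_
  · ext x
    simp only [Set.mem_ofPred_eq, orthonormal_pair_iff, Set.mem_preimage, Set.mem_singleton_iff,
      Prod.mk.injEq, inner_self_eq_norm_sq, pow_eq_one_iff_of_nonneg (norm_nonneg _) two_ne_zero]
  · obtain ⟨u, v, h⟩ := hne
    exact ⟨WithLp.toLp 2 (u, v), h⟩
  · rw [LinearEquiv.finrank_eq (WithLp.linearEquiv 2 ℝ (V × V))]
    simp only [Module.finrank_prod, Module.finrank_self]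
    omega
  · intro x hx
    obtain ⟨hu, hv, huv⟩ := orthonormal_pair_iff.1 hx
    have h1 : HasStrictFDerivAt (fun x : WithLp 2 (V × V) => x.fst) (WithLp.fstL 2 ℝ V V) x :=
      (WithLp.fstL 2 ℝ V V).hasStrictFDerivAt
    have h2 : HasStrictFDerivAt (fun x : WithLp 2 (V × V) => x.snd) (WithLp.sndL 2 ℝ V V) x :=
      (WithLp.sndL 2 ℝ V V).hasStrictFDerivAt
    refine ⟨_, ((RCLike.reCLM (K := 𝕜)).hasStrictFDerivAt.comp x (h1.inner 𝕜 h1)).prodMk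
      (((RCLike.reCLM (K := 𝕜)).hasStrictFDerivAt.comp x (h2.inner 𝕜 h2)).prodMk
        (h1.inner 𝕜 h2)), ?_⟩
    rw [LinearMap.range_eq_top]
    rintro ⟨α, β, γ⟩
    have hhalf : ∀ s : ℝ, ∃ z : 𝕜, RCLike.re z + RCLike.re z = s := fun s =>
      ⟨((s / 2 : ℝ) : 𝕜), by rw [RCLike.ofReal_re]; ring⟩
    obtain ⟨α, rfl⟩ := hhalf α
    obtain ⟨β, rfl⟩ := hhalf β
    -- Scaling `u` and `v` changes the squared norms at rates `2 re α` and `2 re β`. Adding `γ • u`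
    -- to `v` changes only the inner product, at rate `γ`, since `u ⊥ v`.
    refine ⟨WithLp.toLp 2 (α • x.fst, β • x.snd + γ • x.fst), ?_⟩
    have hvu : inner 𝕜 x.snd x.fst = 0 := inner_eq_zero_symm.1 huv
    simp [fderivInnerCLM_apply, inner_smul_left, inner_smul_right, inner_add_left, inner_add_right,
      hu, hv, huv, hvu, inner_self_eq_norm_sq_to_K]

/-- Pairs of vectors in `𝕜 ^ ι` with the Euclidean metric. -/
abbrev PairSpace (𝕜 ι : Type*) [RCLike 𝕜] [Fintype ι] : Type _ :=
  WithLp 2 (EuclideanSpace 𝕜 ι × EuclideanSpace 𝕜 ι)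

/-- The moments of the norm of a row with respect to the volume of a Stiefel manifold. -/
lemma stiefel_lintegral_row [MeasurableSpace (PairSpace 𝕜 ι)] [BorelSpace (PairSpace 𝕜 ι)]
    (hι : 2 ≤ Fintype.card ι)
    {k : ℕ} (hk : k + (2 + Module.finrank ℝ 𝕜) = 2 * (Module.finrank ℝ 𝕜 * Fintype.card ι))
    (i : ι) {p : ℝ} (hp : 0 < p) :
    (μHE[k] : Measure (PairSpace 𝕜 ι))
      {x | Orthonormal 𝕜 ![x.fst, x.snd]} ≠ 0 ∧
    (μHE[k] : Measure (PairSpace 𝕜 ι))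
      {x | Orthonormal 𝕜 ![x.fst, x.snd]} ≠ ⊤ ∧
    ∫⁻ x in {x : PairSpace 𝕜 ι | Orthonormal 𝕜 ![x.fst, x.snd]},
        ENNReal.ofReal ((‖x.fst i‖ ^ 2 + ‖x.snd i‖ ^ 2) ^ p) ∂μHE[k] =
      ENNReal.ofReal (projMoment (Module.finrank ℝ 𝕜 * Fintype.card ι)
        (Module.finrank ℝ 𝕜 * 2) (2 * p)) *
      (μHE[k] : Measure (PairSpace 𝕜 ι))
        {x | Orthonormal 𝕜 ![x.fst, x.snd]} := by
  set M : Set (PairSpace 𝕜 ι) := {x | Orthonormal 𝕜 ![x.fst, x.snd]} with hM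
  obtain ⟨h0, h1⟩ := orthonormalPairs_volume (𝕜 := 𝕜) (V := EuclideanSpace 𝕜 ι) (k := k) (by
    obtain ⟨a, b, hab⟩ := Fintype.one_lt_card_iff.1 hι
    refine ⟨EuclideanSpace.single a 1, EuclideanSpace.single b 1, orthonormal_pair_iff.2 ?_⟩
    simp [EuclideanSpace.inner_single_left, hab]) (by
      rw [hk, (WithLp.linearEquiv 2 ℝ (ι → 𝕜)).finrank_eq, Module.finrank_pi_fintype]
      simp [mul_comm])
  refine ⟨h0, h1, ?_⟩
  have hMc : MeasurableSet M := (isCompact_orthonormalPairs 𝕜 (EuclideanSpace 𝕜 ι)).measurableSet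
  have hfin : IsFiniteMeasure ((μHE[k] : Measure (PairSpace 𝕜 ι)).restrict M) := ⟨by
    rw [Measure.restrict_apply_univ]; exact h1.lt_top⟩
  let G := Matrix.unitaryGroup ι 𝕜
  borelize ↥G
  borelize (EuclideanSpace 𝕜 ι)
  obtain ⟨ν, hν, hν', hν''⟩ := exists_invariant_probability ↥G
  -- The unitary group acts diagonally on pairs, by isometries that preserve the set of frames.
  let ρ : ↥G → (PairSpace 𝕜 ι ≃ₗᵢ[𝕜] PairSpace 𝕜 ι) := fun g =>
    { toFun := fun x => WithLp.toLp 2 (unitaryIsometry g x.fst, unitaryIsometry g x.snd)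
      invFun := fun x => WithLp.toLp 2
        ((unitaryIsometry g).symm x.fst, (unitaryIsometry g).symm x.snd)
      map_add' := fun x y => by simp; rfl
      map_smul' := fun c x => by simp; rfl
      left_inv := fun x => by simp; rfl
      right_inv := fun x => by simp; rfl
      norm_map' := fun x => by
        rw [← sq_eq_sq₀ (norm_nonneg _) (norm_nonneg _)]
        simp [WithLp.prod_norm_sq_eq_of_L2] }
  have hρ : Measurable fun z : ↥G × PairSpace 𝕜 ι => ρ z.1 z.2 := by
    have h1 : Continuous fun z : ↥G × PairSpace 𝕜 ι => unitaryIsometry z.1 z.2.fst :=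
      continuous_unitaryIsometry.comp (f := fun z : ↥G × PairSpace 𝕜 ι => (z.1, z.2.fst)) (by fun_prop)
    have h2 : Continuous fun z : ↥G × PairSpace 𝕜 ι => unitaryIsometry z.1 z.2.snd :=
      continuous_unitaryIsometry.comp (f := fun z : ↥G × PairSpace 𝕜 ι => (z.1, z.2.snd)) (by fun_prop)
    exact ((WithLp.prod_continuous_toLp 2 _ _).comp (h1.prodMk h2)).measurable
  have hρM : ∀ g, MeasurePreserving (ρ g) ((μHE[k] : Measure (PairSpace 𝕜 ι)).restrict M)
      ((μHE[k] : Measure (PairSpace 𝕜 ι)).restrict M) := by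
    intro g
    have := ((ρ g).toIsometryEquiv.measurePreserving_euclideanHausdorffMeasure k).restrict_preimage
      hMc
    have hs : (ρ g).toIsometryEquiv ⁻¹' M = M := by
      ext x
      change Orthonormal 𝕜 ![unitaryIsometry g x.fst, unitaryIsometry g x.snd] ↔
        Orthonormal 𝕜 ![x.fst, x.snd]
      simp
    rw [hs] at this
    exact this
  have hcont : Continuous fun x : PairSpace 𝕜 ι => (‖x.fst i‖ ^ 2 + ‖x.snd i‖ ^ 2) := by fun_prop
  have hmeas := hcont.measurable
  rw [lintegral_eq_lintegral_average (ν := ν) (ρ := fun g => ρ g) hρ hρM (by fun_prop)]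
  have : ∀ᵐ x ∂((μHE[k] : Measure (PairSpace 𝕜 ι)).restrict M),
      ∫⁻ g, ENNReal.ofReal ((‖(ρ g x).fst i‖ ^ 2 + ‖(ρ g x).snd i‖ ^ 2) ^ p) ∂ν =
      ENNReal.ofReal (projMoment (Module.finrank ℝ 𝕜 * Fintype.card ι)
        (Module.finrank ℝ 𝕜 * 2) (2 * p)) := by
    filter_upwards [ae_restrict_mem hMc] with x hx
    exact lintegral_frame_orbit ν hι hx i hp
  rw [lintegral_congr_ae this]
  simp

end Stiefel

/-! ### Moments of coordinates on subsets of `ℍⁿ` -/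

/-- The set `M` has positive finite `k`-dimensional volume and `m` is the `p`-th moment of `|qᵢ|²`
for the normalized volume of `M`. -/
structure IsCoordMoment {n : ℕ} (k : ℕ) (M : Set (HSpace n)) (i : Fin n) (p m : ℝ) : Prop where
  measurableSet : MeasurableSet M
  ne_zero : (μHE[k] : Measure (HSpace n)) M ≠ 0
  ne_top : (μHE[k] : Measure (HSpace n)) M ≠ ⊤
  lintegral : ∫⁻ q in M, ENNReal.ofReal ((‖q i‖ ^ 2) ^ p) ∂μHE[k] =
    ENNReal.ofReal m * (μHE[k] : Measure (HSpace n)) M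

section Transfer

variable {n : ℕ} {k : ℕ} {i : Fin n} {p m : ℝ}

lemma measurable_coord_rpow (i : Fin n) (p : ℝ) :
    Measurable fun q : HSpace n => (‖q i‖ ^ 2) ^ p := by
  have h : Continuous fun q : HSpace n => ‖q i‖ ^ 2 := by fun_prop
  exact h.measurable.pow_const p

/-- Isometries preserve Hausdorff measure, so the volume of the image is the push-forward.
Completeness makes `L` a closed embedding. -/
lemma isCoordMoment_image {U : Type*} [MetricSpace U] [CompleteSpace U] [MeasurableSpace U]
    [BorelSpace U] {L : U → HSpace n} (hL : Isometry L) {M : Set U} (hM : MeasurableSet M)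
    (h0 : (μHE[k] : Measure U) M ≠ 0) (h1 : (μHE[k] : Measure U) M ≠ ⊤)
    (h : ∫⁻ x in M, ENNReal.ofReal ((‖L x i‖ ^ 2) ^ p) ∂μHE[k] =
      ENNReal.ofReal m * (μHE[k] : Measure U) M) : IsCoordMoment k (L '' M) i p m := by
  have hemb : MeasurableEmbedding L := hL.isClosedEmbedding.measurableEmbedding
  have hmap : (μHE[k] : Measure (HSpace n)).restrict (L '' M) =
      ((μHE[k] : Measure U).restrict M).map L := by
    rw [← Measure.restrict_restrict_of_subset (Set.image_subset_range L M),
      ← hL.map_euclideanHausdorffMeasure, hemb.restrict_map,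
      Set.preimage_image_eq _ hL.injective]
  refine ⟨hemb.measurableSet_image.2 hM, ?_, ?_, ?_⟩
  · rwa [hL.euclideanHausdorffMeasure_image]
  · rwa [hL.euclideanHausdorffMeasure_image]
  · rw [hmap, hemb.lintegral_map, h, hL.euclideanHausdorffMeasure_image]

/-- Both pieces have the same mean `m`, so their relative volumes play no role. -/
lemma IsCoordMoment.union {M N : Set (HSpace n)} (hM : IsCoordMoment k M i p m)
    (hN : IsCoordMoment k N i p m) (hd : Disjoint M N) : IsCoordMoment k (M ∪ N) i p m where
  measurableSet := hM.measurableSet.union hN.measurableSet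
  ne_zero := fun h => hM.ne_zero (measure_mono_null Set.subset_union_left h)
  ne_top := measure_union_ne_top hM.ne_top hN.ne_top
  lintegral := by
    rw [lintegral_union hN.measurableSet hd, hM.lintegral, hN.lintegral,
      measure_union hd hN.measurableSet, mul_add]

/-- The intrinsic Hausdorff measure of `M` pushes forward to the restriction of the ambient one, and
normalization cancels the total volume. -/
lemma IsCoordMoment.edgeMoment_eq {M : Set (HSpace n)} (hM : IsCoordMoment k M i p m) (hm : 0 ≤ m)
    {d : ℕ} {P : Set (Fin n → EuclideanSpace ℝ (Fin d))}
    {h : HSpace n → Fin n → EuclideanSpace ℝ (Fin d)} (hc : Continuous h) (hMP : Set.MapsTo h M P)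
    (hn : ∀ q ∈ M, ‖h q i‖ = ‖q i‖ ^ 2) :
    edgeMoment ((normalizedVolume k M).map (hMP.restrict h _ _)) i p = m := by
  have hcr : Continuous (hMP.restrict h _ _) := hc.restrict hMP
  have hval : (μHE[k] : Measure M).map Subtype.val = (μHE[k] : Measure (HSpace n)).restrict M := by
    rw [isometry_subtype_coe.map_euclideanHausdorffMeasure, Subtype.range_coe]
  have huniv : (μHE[k] : Measure M) Set.univ = (μHE[k] : Measure (HSpace n)) M := by
    rw [← isometry_subtype_coe.euclideanHausdorffMeasure_image, Set.image_univ, Subtype.range_coe]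
  have hmeas : Measurable fun e : P => ‖(e : Fin n → EuclideanSpace ℝ (Fin d)) i‖ ^ p := by
    have : Continuous fun e : P => ‖(e : Fin n → EuclideanSpace ℝ (Fin d)) i‖ :=
      ((continuous_apply i).comp continuous_subtype_val).norm
    exact this.measurable.pow_const p
  rw [edgeMoment, integral_eq_lintegral_of_nonneg_ae
    (Filter.Eventually.of_forall fun e => by positivity) hmeas.aestronglyMeasurable,
    lintegral_map hmeas.ennreal_ofReal hcr.measurable, normalizedVolume, lintegral_smul_measure]
  have hint : ∫⁻ q : M, ENNReal.ofReal
      (‖((hMP.restrict h _ _ q : P) : Fin n → EuclideanSpace ℝ (Fin d)) i‖ ^ p) ∂μHE[k] =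
      ∫⁻ q : M, ENNReal.ofReal ((‖(q : HSpace n) i‖ ^ 2) ^ p) ∂μHE[k] :=
    lintegral_congr fun q => by rw [Set.MapsTo.val_restrict_apply, hn q q.2]
  have hsub : ∫⁻ q : M, ENNReal.ofReal ((‖(q : HSpace n) i‖ ^ 2) ^ p) ∂μHE[k] =
      ENNReal.ofReal m * (μHE[k] : Measure (HSpace n)) M := by
    rw [← hM.lintegral, ← hval,
      lintegral_map (measurable_coord_rpow i p).ennreal_ofReal measurable_subtype_coe]
  rw [hint, hsub, huniv, smul_eq_mul, mul_left_comm, ENNReal.inv_mul_cancel hM.ne_zero hM.ne_top,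
    mul_one, ENNReal.toReal_ofReal hm]

/-- Left multiplication by `𝐢` on `ℍⁿ`. -/
def mulI (q : HSpace n) : HSpace n := WithLp.toLp 2 fun i => qI * q i

lemma norm_qI : ‖qI‖ = 1 := by
  have := norm_sq_quaternion qI
  simp only [qI_re, qI_imI, qI_imJ, qI_imK] at this
  nlinarith [norm_nonneg qI]

lemma norm_mulI_apply (q : HSpace n) (i : Fin n) : ‖mulI q i‖ = ‖q i‖ := by
  simp [mulI, norm_qI]

lemma norm_mulI (q : HSpace n) : ‖mulI q‖ = ‖q‖ := by
  rw [← sq_eq_sq₀ (norm_nonneg _) (norm_nonneg _), PiLp.norm_sq_eq_of_L2, PiLp.norm_sq_eq_of_L2]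
  simp only [norm_mulI_apply]

lemma isometry_mulI : Isometry (mulI : HSpace n → HSpace n) := by
  let f : HSpace n →+ HSpace n := AddMonoidHom.mk' mulI fun a b => by
    ext1 i; simp [mulI, mul_add]
  exact AddMonoidHomClass.isometry_of_norm f norm_mulI

lemma IsCoordMoment.image_mulI {M : Set (HSpace n)} (hM : IsCoordMoment k M i p m) :
    IsCoordMoment k (mulI '' M) i p m :=
  isCoordMoment_image isometry_mulI hM.measurableSet hM.ne_zero hM.ne_top (by
    simp only [norm_mulI_apply, hM.lintegral])

end Transfer

/-! ### Moments on the model manifolds -/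

section Models

variable {n : ℕ}

lemma coord_sphere {F : Type*} [NormedAddCommGroup F] [InnerProductSpace ℝ F]
    [FiniteDimensional ℝ F] [Nontrivial F] [MeasurableSpace (PiLp 2 fun _ : Fin n => F)]
    [BorelSpace (PiLp 2 fun _ : Fin n => F)] (i : Fin n) {p : ℝ} (hp : 0 < p) {k : ℕ}
    (hk : k + 1 = n * Module.finrank ℝ F) :
    (μHE[k] : Measure (PiLp 2 fun _ : Fin n => F)) (Metric.sphere 0 (Real.sqrt 2)) ≠ 0 ∧
    (μHE[k] : Measure (PiLp 2 fun _ : Fin n => F)) (Metric.sphere 0 (Real.sqrt 2)) ≠ ⊤ ∧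
    ∫⁻ x in Metric.sphere (0 : PiLp 2 fun _ : Fin n => F) (Real.sqrt 2),
        ENNReal.ofReal ((‖x i‖ ^ 2) ^ p) ∂μHE[k] =
      ENNReal.ofReal (2 ^ p * projMoment (n * Module.finrank ℝ F) (Module.finrank ℝ F) (2 * p)) *
        μHE[k] (Metric.sphere (0 : PiLp 2 fun _ : Fin n => F) (Real.sqrt 2)) := by
  have : Nonempty (Fin n) := ⟨i⟩
  have hfr : Module.finrank ℝ (PiLp 2 fun _ : Fin n => F) = n * Module.finrank ℝ F := by
    rw [(WithLp.linearEquiv 2 ℝ (Fin n → F)).finrank_eq, Module.finrank_pi_fintype]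
    simp
  have : Nontrivial (PiLp 2 fun _ : Fin n => F) :=
    Module.nontrivial_of_finrank_pos (R := ℝ) (by rw [hfr, ← hk]; omega)
  let S : F →ₗᵢ[ℝ] PiLp 2 fun _ : Fin n => F :=
    { toFun := fun w => PiLp.single 2 i w
      map_add' := fun w w' => by ext j; rcases eq_or_ne j i with rfl | h <;> simp [*]
      map_smul' := fun c w => by ext j; rcases eq_or_ne j i with rfl | h <;> simp [*]
      norm_map' := fun w => by simp }
  have := sphere_lintegral_norm_adjoint (r := Real.sqrt 2) (by positivity) S
    (PiLp.proj 2 (fun _ : Fin n => F) i) (fun w x => by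
      rw [PiLp.inner_apply, Finset.sum_eq_single i (fun j _ h => by simp [S, h]) (by simp)]
      simp [S])
    (mul_pos two_pos hp) (hk.trans hfr.symm)
  -- The factor `2 ^ p` is `√2 ^ (2 * p)`, from the radius.
  rw [hfr, Real.rpow_mul (Real.sqrt_nonneg 2), Real.rpow_two, Real.sq_sqrt two_pos.le] at this
  simp only [Real.rpow_mul (norm_nonneg _), Real.rpow_two] at this
  exact this

lemma isCoordMoment_sphere3 (i : Fin n) {p : ℝ} (hp : 0 < p) :
    IsCoordMoment (4 * n - 1) (sphere3 n) i p (2 ^ p * projMoment (n * 4) 4 (2 * p)) := by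
  -- Positivity of `n` keeps `4 * n - 1` from being truncated.
  have hn := i.pos
  have h4 : Module.finrank ℝ ℍ = 4 := Quaternion.finrank_eq_four
  have := coord_sphere (F := ℍ) i hp (k := 4 * n - 1) (by rw [h4]; omega)
  rw [h4] at this
  exact ⟨Metric.isClosed_sphere.measurableSet, this.1, this.2.1, this.2.2⟩

/-- The embedding of `ℂⁿ` onto `(1 ⊕ 𝐣)ⁿ`. -/
def planeEmb (x : PiLp 2 fun _ : Fin n => ℂ) : HSpace n :=
  WithLp.toLp 2 fun i => ((x i).re : ℍ) + ((x i).im : ℍ) * qJ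

lemma norm_planeEmb_apply (x : PiLp 2 fun _ : Fin n => ℂ) (i : Fin n) :
    ‖planeEmb x i‖ = ‖x i‖ := by
  rw [← sq_eq_sq₀ (norm_nonneg _) (norm_nonneg _), norm_sq_quaternion, Complex.sq_norm,
    Complex.normSq_apply]
  simp [planeEmb]; ring

lemma norm_planeEmb (x : PiLp 2 fun _ : Fin n => ℂ) : ‖planeEmb x‖ = ‖x‖ := by
  rw [← sq_eq_sq₀ (norm_nonneg _) (norm_nonneg _), PiLp.norm_sq_eq_of_L2, PiLp.norm_sq_eq_of_L2]
  simp only [norm_planeEmb_apply]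

lemma isometry_planeEmb : Isometry (planeEmb : _ → HSpace n) := by
  let f : (PiLp 2 fun _ : Fin n => ℂ) →+ HSpace n := AddMonoidHom.mk' planeEmb fun a b => by
    ext i <;> simp [planeEmb]
  exact AddMonoidHomClass.isometry_of_norm f norm_planeEmb

/-- Since `𝐢 (x + y 𝐣) = x 𝐢 + y 𝐤`, the second sphere is `𝐢` times the first. -/
lemma spheres2_eq (n : ℕ) : spheres2 n =
    planeEmb '' Metric.sphere 0 (Real.sqrt 2) ∪
      mulI '' (planeEmb '' Metric.sphere (0 : PiLp 2 fun _ : Fin n => ℂ) (Real.sqrt 2)) := by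
  rw [spheres2]
  congr 1
  · ext q
    simp only [Set.mem_ofPred_eq, Set.mem_image, mem_sphere_zero_iff_norm]
    constructor
    · rintro ⟨hq, h⟩
      have he : planeEmb (WithLp.toLp 2 fun i => (⟨(q i).re, (q i).imJ⟩ : ℂ)) = q := by
        ext i <;> simp [planeEmb, h i]
      exact ⟨_, by rw [← norm_planeEmb, he, hq], he⟩
    · rintro ⟨x, hx, rfl⟩
      exact ⟨by rw [norm_planeEmb, hx], fun i => by simp [planeEmb]⟩
  · ext q
    simp only [Set.mem_ofPred_eq, Set.mem_image, mem_sphere_zero_iff_norm, exists_exists_and_eq_and]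
    constructor
    · rintro ⟨hq, h⟩
      have he : mulI (planeEmb (WithLp.toLp 2 fun i => (⟨(q i).imI, (q i).imK⟩ : ℂ))) = q := by
        ext i <;> simp [planeEmb, mulI, h i]
      exact ⟨_, by rw [← norm_planeEmb, ← norm_mulI, he, hq], he⟩
    · rintro ⟨x, hx, rfl⟩
      exact ⟨by rw [norm_mulI, norm_planeEmb, hx], fun i => by simp [planeEmb, mulI]⟩

/-- Sets of nonzero points with coordinates in `1 ⊕ 𝐣` are moved off themselves by `𝐢`. -/
lemma disjoint_image_mulI {M : Set (HSpace n)}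
    (h : ∀ q ∈ M, q ≠ 0 ∧ ∀ i, (q i).imI = 0 ∧ (q i).imK = 0) : Disjoint M (mulI '' M) := by
  rw [Set.disjoint_left]
  rintro _ h1 ⟨q, h2, rfl⟩
  refine (h q h2).1 ?_
  -- The `𝐢` and `𝐤` coordinates of `𝐢 q` are the `1` and `𝐣` coordinates of `q`, so these vanish
  -- too.
  have h3 := (h _ h1).2
  ext i
  · simpa [mulI] using (h3 i).1
  · exact ((h q h2).2 i).1
  · simpa [mulI] using (h3 i).2
  · exact ((h q h2).2 i).2

lemma isCoordMoment_spheres2 (i : Fin n) {p : ℝ} (hp : 0 < p) :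
    IsCoordMoment (2 * n - 1) (spheres2 n) i p (2 ^ p * projMoment (n * 2) 2 (2 * p)) := by
  have hn := i.pos
  have h2 : Module.finrank ℝ ℂ = 2 := Complex.finrank_real_complex
  have := coord_sphere (F := ℂ) i hp (k := 2 * n - 1) (by rw [h2]; omega)
  rw [h2] at this
  have h1 := isCoordMoment_image (isometry_planeEmb (n := n)) (i := i) (p := p)
    Metric.isClosed_sphere.measurableSet this.1 this.2.1 (by
      simp only [norm_planeEmb_apply]; exact this.2.2)
  rw [spheres2_eq]
  refine h1.union h1.image_mulI (disjoint_image_mulI ?_)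
  rintro _ ⟨x, hx, rfl⟩
  refine ⟨?_, fun i => by simp [planeEmb]⟩
  rw [← norm_ne_zero_iff, norm_planeEmb, mem_sphere_zero_iff_norm.1 hx]
  positivity

/-- The map `(u, v) ↦ u + v 𝐣` on pairs of complex vectors. -/
def complexFrameEmb (x : PairSpace ℂ (Fin n)) : HSpace n :=
  WithLp.toLp 2 fun i => (x.fst i : ℍ) + (x.snd i : ℍ) * qJ

/-- The map `(u, v) ↦ u + v 𝐣` on pairs of real vectors. -/
def realFrameEmb (x : PairSpace ℝ (Fin n)) : HSpace n :=
  WithLp.toLp 2 fun i => (x.fst i : ℍ) + (x.snd i : ℍ) * qJ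

lemma norm_sq_complexFrameEmb_apply (x : PairSpace ℂ (Fin n)) (i : Fin n) :
    ‖complexFrameEmb x i‖ ^ 2 = ‖x.fst i‖ ^ 2 + ‖x.snd i‖ ^ 2 := by
  rw [norm_sq_quaternion, Complex.sq_norm, Complex.sq_norm, Complex.normSq_apply,
    Complex.normSq_apply]
  simp [complexFrameEmb]; ring

lemma norm_sq_realFrameEmb_apply (x : PairSpace ℝ (Fin n)) (i : Fin n) :
    ‖realFrameEmb x i‖ ^ 2 = ‖x.fst i‖ ^ 2 + ‖x.snd i‖ ^ 2 := by
  rw [norm_sq_quaternion]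
  simp [realFrameEmb]

lemma isometry_complexFrameEmb : Isometry (complexFrameEmb : _ → HSpace n) := by
  let f : PairSpace ℂ (Fin n) →+ HSpace n := AddMonoidHom.mk' complexFrameEmb fun a b => by
    ext i <;> simp [complexFrameEmb]
  refine AddMonoidHomClass.isometry_of_norm f fun x => ?_
  rw [← sq_eq_sq₀ (norm_nonneg _) (norm_nonneg _), PiLp.norm_sq_eq_of_L2,
    WithLp.prod_norm_sq_eq_of_L2, PiLp.norm_sq_eq_of_L2, PiLp.norm_sq_eq_of_L2,
    ← Finset.sum_add_distrib]
  exact Finset.sum_congr rfl fun i _ => norm_sq_complexFrameEmb_apply x i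

lemma isometry_realFrameEmb : Isometry (realFrameEmb : _ → HSpace n) := by
  let f : PairSpace ℝ (Fin n) →+ HSpace n := AddMonoidHom.mk' realFrameEmb fun a b => by
    ext i <;> simp [realFrameEmb]
  refine AddMonoidHomClass.isometry_of_norm f fun x => ?_
  rw [← sq_eq_sq₀ (norm_nonneg _) (norm_nonneg _), PiLp.norm_sq_eq_of_L2,
    WithLp.prod_norm_sq_eq_of_L2, PiLp.norm_sq_eq_of_L2, PiLp.norm_sq_eq_of_L2,
    ← Finset.sum_add_distrib]
  exact Finset.sum_congr rfl fun i _ => norm_sq_realFrameEmb_apply x i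

lemma stiefelComplex_eq (n : ℕ) : stiefelComplex n =
    complexFrameEmb '' {x : PairSpace ℂ (Fin n) | Orthonormal ℂ ![x.fst, x.snd]} := by
  ext q
  constructor
  · rintro ⟨u, v, h, hq⟩
    exact ⟨WithLp.toLp 2 (u, v), h, by ext1 i; exact (hq i).symm⟩
  · rintro ⟨x, h, rfl⟩
    exact ⟨x.fst, x.snd, h, fun i => rfl⟩

lemma stiefelReal_eq (n : ℕ) : stiefelReal n =
    realFrameEmb '' {x : PairSpace ℝ (Fin n) | Orthonormal ℝ ![x.fst, x.snd]} ∪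
      mulI '' (realFrameEmb '' {x : PairSpace ℝ (Fin n) | Orthonormal ℝ ![x.fst, x.snd]}) := by
  rw [stiefelReal]
  congr 1
  · ext q
    constructor
    · rintro ⟨u, v, h, hq⟩
      exact ⟨WithLp.toLp 2 (u, v), h, by ext1 i; exact (hq i).symm⟩
    · rintro ⟨x, h, rfl⟩
      exact ⟨x.fst, x.snd, h, fun i => rfl⟩
  · ext q
    constructor
    · rintro ⟨u, v, h, hq⟩
      exact ⟨_, ⟨WithLp.toLp 2 (u, v), h, rfl⟩, by ext1 i; exact (hq i).symm⟩
    · rintro ⟨_, ⟨x, h, rfl⟩, rfl⟩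
      exact ⟨x.fst, x.snd, h, fun i => rfl⟩

/-- A row lies in `ℂ²`, of real dimension `4`, and is distributed like two coordinates of a uniform
unit vector of `ℂⁿ = ℝ²ⁿ`. -/
lemma isCoordMoment_stiefelComplex (hn : 2 ≤ n) (i : Fin n) {p : ℝ} (hp : 0 < p) :
    IsCoordMoment (4 * n - 4) (stiefelComplex n) i p (projMoment (2 * n) 4 (2 * p)) := by
  have h2 : Module.finrank ℝ ℂ = 2 := Complex.finrank_real_complex
  obtain ⟨h0, h1, h⟩ := stiefel_lintegral_row (𝕜 := ℂ) (ι := Fin n) (k := 4 * n - 4) (by simpa)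
    (by rw [h2, Fintype.card_fin]; omega) i hp
  rw [h2, Fintype.card_fin] at h
  rw [stiefelComplex_eq]
  refine isCoordMoment_image isometry_complexFrameEmb
    (isCompact_orthonormalPairs ℂ (EuclideanSpace ℂ (Fin n))).measurableSet h0 h1 ?_
  simp only [norm_sq_complexFrameEmb_apply]
  exact h

lemma isCoordMoment_stiefelReal (hn : 2 ≤ n) (i : Fin n) {p : ℝ} (hp : 0 < p) :
    IsCoordMoment (2 * n - 3) (stiefelReal n) i p (projMoment n 2 (2 * p)) := by
  obtain ⟨h0, h1, h⟩ := stiefel_lintegral_row (𝕜 := ℝ) (ι := Fin n) (k := 2 * n - 3) (by simpa)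
    (by rw [Module.finrank_self, Fintype.card_fin]; omega) i hp
  rw [Module.finrank_self, Fintype.card_fin, one_mul, one_mul] at h
  rw [stiefelReal_eq]
  have hM := isCoordMoment_image (i := i) (p := p) isometry_realFrameEmb
    (isCompact_orthonormalPairs ℝ (EuclideanSpace ℝ (Fin n))).measurableSet h0 h1 (by
      simp only [norm_sq_realFrameEmb_apply]; exact h)
  refine hM.union hM.image_mulI (disjoint_image_mulI ?_)
  rintro _ ⟨x, hx, rfl⟩
  refine ⟨fun h0 => ?_, fun i => by simp [realFrameEmb]⟩
  have hx0 : x = 0 := isometry_realFrameEmb.injective (h0.trans (by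
    ext i <;> simp [realFrameEmb]))
  have := (orthonormal_pair_iff.1 hx).1
  simp [hx0] at this

end Models

/-! ### Evaluation of the moments -/

section Evaluation

/-- `Γ(p)` cancels in the quotient of Beta values. -/
lemma projMoment_eq_beta_div_beta {N k : ℕ} (hN : 0 < N) (hk : 0 < k) {p : ℝ} (hp : 0 < p) :
    projMoment N k (2 * p) =
      ProbabilityTheory.beta p (N / 2) / ProbabilityTheory.beta p (k / 2) := by
  have hN' : (0 : ℝ) < N := by exact_mod_cast hN
  have hk' : (0 : ℝ) < k := by exact_mod_cast hk
  have h1 := Real.Gamma_pos_of_pos (show (0 : ℝ) < N / 2 by positivity)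
  have h2 := Real.Gamma_pos_of_pos (show (0 : ℝ) < p + N / 2 by positivity)
  have h3 := Real.Gamma_pos_of_pos (show (0 : ℝ) < k / 2 by positivity)
  have h4 := Real.Gamma_pos_of_pos (show (0 : ℝ) < p + k / 2 by positivity)
  have h5 := Real.Gamma_pos_of_pos hp
  rw [projMoment, ProbabilityTheory.beta, ProbabilityTheory.beta,
    show ((k : ℝ) + 2 * p) / 2 = p + k / 2 by ring, show ((N : ℝ) + 2 * p) / 2 = p + N / 2 by ring]
  field_simp

lemma beta_two_left {x : ℝ} (hx : 0 < x) : ProbabilityTheory.beta 2 x = 1 / (x * (x + 1)) := by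
  have h := Real.Gamma_pos_of_pos hx
  rw [ProbabilityTheory.beta, Real.Gamma_two, show (2 : ℝ) + x = x + 1 + 1 by ring,
    Real.Gamma_add_one (by positivity), Real.Gamma_add_one (by positivity)]
  field_simp

lemma continuous_hopf : Continuous hopf :=
  (continuous_star.mul continuous_const).mul continuous_id

lemma continuous_hopf3 {n : ℕ} : Continuous (hopf3 : HSpace n → _) := by
  have h : ∀ i, Continuous fun q : HSpace n => hopf (q i) :=
    fun i => continuous_hopf.comp (by fun_prop)
  refine continuous_pi fun i => (PiLp.continuous_toLp 2 _).comp (continuous_pi fun j => ?_)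
  fin_cases j
  · exact Quaternion.continuous_imI.comp (h i)
  · exact Quaternion.continuous_imJ.comp (h i)
  · exact Quaternion.continuous_imK.comp (h i)

lemma continuous_hopf2 {n : ℕ} : Continuous (hopf2 : HSpace n → _) := by
  have h : ∀ i, Continuous fun q : HSpace n => hopf (q i) :=
    fun i => continuous_hopf.comp (by fun_prop)
  refine continuous_pi fun i => (PiLp.continuous_toLp 2 _).comp (continuous_pi fun j => ?_)
  fin_cases j
  · exact Quaternion.continuous_imI.comp (h i)
  · exact Quaternion.continuous_imK.comp (h i)

variable {n : ℕ} (i : Fin n) {p : ℝ}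

lemma beta_div_beta_nonneg {p x y : ℝ} (hp : 0 < p) (hx : 0 < x) (hy : 0 < y) :
    0 ≤ ProbabilityTheory.beta p x / ProbabilityTheory.beta p y :=
  (div_pos (ProbabilityTheory.beta_pos hp hx) (ProbabilityTheory.beta_pos hp hy)).le

lemma edgeMoment_armMeasure3 (hp : 0 < p) : edgeMoment (armMeasure3 n) i p =
    2 ^ p * ProbabilityTheory.beta p (2 * n) / ProbabilityTheory.beta p 2 := by
  have hn : (0 : ℝ) < n := by exact_mod_cast i.pos
  have hm : (2 : ℝ) ^ p * projMoment (n * 4) 4 (2 * p) =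
      2 ^ p * ProbabilityTheory.beta p (2 * n) / ProbabilityTheory.beta p 2 := by
    rw [projMoment_eq_beta_div_beta (by have := i.pos; omega) four_pos hp, mul_div_assoc]
    push_cast
    rw [show (n * 4 : ℝ) / 2 = 2 * n by ring, show (4 : ℝ) / 2 = 2 by norm_num]
  rw [← hm]
  refine (isCoordMoment_sphere3 i hp).edgeMoment_eq ?_ continuous_hopf3 (mapsTo_sphere3 n)
    fun q _ => norm_hopf3 q i
  rw [hm, mul_div_assoc]
  exact mul_nonneg (by positivity) (beta_div_beta_nonneg hp (by positivity) two_pos)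

lemma edgeMoment_polMeasure3 (hn : 2 ≤ n) (hp : 0 < p) : edgeMoment (polMeasure3 n) i p =
    ProbabilityTheory.beta p n / ProbabilityTheory.beta p 2 := by
  have hn' : (0 : ℝ) < n := by exact_mod_cast i.pos
  have hm : projMoment (2 * n) 4 (2 * p) =
      ProbabilityTheory.beta p n / ProbabilityTheory.beta p 2 := by
    rw [projMoment_eq_beta_div_beta (by have := i.pos; omega) four_pos hp]
    push_cast
    rw [show (2 * n : ℝ) / 2 = n by ring, show (4 : ℝ) / 2 = 2 by norm_num]
  rw [← hm]
  refine (isCoordMoment_stiefelComplex hn i hp).edgeMoment_eq ?_ continuous_hopf3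
    (mapsTo_stiefelComplex n) fun q _ => norm_hopf3 q i
  rw [hm]
  exact beta_div_beta_nonneg hp hn' two_pos

lemma edgeMoment_armMeasure2 (hp : 0 < p) : edgeMoment (armMeasure2 n) i p =
    2 ^ p * ProbabilityTheory.beta p n / ProbabilityTheory.beta p 1 := by
  have hn : (0 : ℝ) < n := by exact_mod_cast i.pos
  have hm : (2 : ℝ) ^ p * projMoment (n * 2) 2 (2 * p) =
      2 ^ p * ProbabilityTheory.beta p n / ProbabilityTheory.beta p 1 := by
    rw [projMoment_eq_beta_div_beta (by have := i.pos; omega) two_pos hp, mul_div_assoc]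
    push_cast
    rw [show (n * 2 : ℝ) / 2 = n by ring, show (2 : ℝ) / 2 = 1 by norm_num]
  rw [← hm]
  refine (isCoordMoment_spheres2 i hp).edgeMoment_eq ?_ continuous_hopf2 (mapsTo_spheres2 n) ?_
  · rw [hm, mul_div_assoc]
    exact mul_nonneg (by positivity) (beta_div_beta_nonneg hp hn one_pos)
  -- On either sphere the `𝐣` coordinate of the Hopf image vanishes, so dropping it preserves the
  -- norm.
  · rintro q (⟨-, h⟩ | ⟨-, h⟩) <;> exact norm_hopf2 q i (by simp [hopf_imJ, h i])

lemma edgeMoment_polMeasure2 (hn : 2 ≤ n) (hp : 0 < p) : edgeMoment (polMeasure2 n) i p =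
    ProbabilityTheory.beta p (n / 2) / ProbabilityTheory.beta p 1 := by
  have hn' : (0 : ℝ) < n := by exact_mod_cast i.pos
  have hm : projMoment n 2 (2 * p) =
      ProbabilityTheory.beta p (n / 2) / ProbabilityTheory.beta p 1 := by
    rw [projMoment_eq_beta_div_beta i.pos two_pos hp]
    push_cast
    rw [show (2 : ℝ) / 2 = 1 by norm_num]
  rw [← hm]
  refine (isCoordMoment_stiefelReal hn i hp).edgeMoment_eq ?_ continuous_hopf2
    (mapsTo_stiefelReal n) ?_
  · rw [hm]
    exact beta_div_beta_nonneg hp (by positivity) one_pos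
  · rintro q (⟨u, v, -, h⟩ | ⟨u, v, -, h⟩) <;> exact norm_hopf2 q i (by simp [hopf_imJ, h i])

end Evaluation

end

end PolygonSpace

theorem proposition5p1 :
    (∀ (n : ℕ) (i : Fin n) (p : ℝ), 0 < p →
      PolygonSpace.edgeMoment (PolygonSpace.armMeasure3 n) i p =
        2 ^ p * ProbabilityTheory.beta p (2 * n) / ProbabilityTheory.beta p 2) ∧
    (∀ (n : ℕ) (i : Fin n) (p : ℝ), 2 ≤ n → 0 < p →
      PolygonSpace.edgeMoment (PolygonSpace.polMeasure3 n) i p =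
        ProbabilityTheory.beta p n / ProbabilityTheory.beta p 2) ∧
    (∀ (n : ℕ) (i : Fin n) (p : ℝ), 0 < p →
      PolygonSpace.edgeMoment (PolygonSpace.armMeasure2 n) i p =
        2 ^ p * ProbabilityTheory.beta p n / ProbabilityTheory.beta p 1) ∧
    (∀ (n : ℕ) (i : Fin n) (p : ℝ), 2 ≤ n → 0 < p →
      PolygonSpace.edgeMoment (PolygonSpace.polMeasure2 n) i p =
        ProbabilityTheory.beta p (n / 2) / ProbabilityTheory.beta p 1) ∧
    (∀ (n : ℕ) (i : Fin n),
      PolygonSpace.edgeMoment (PolygonSpace.armMeasure3 n) i 2 =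
        6 / ((n : ℝ) * ((n : ℝ) + 1 / 2))) ∧
    (∀ (n : ℕ) (i : Fin n), 2 ≤ n →
      PolygonSpace.edgeMoment (PolygonSpace.polMeasure3 n) i 2 =
        6 / ((n : ℝ) * ((n : ℝ) + 1))) ∧
    (∀ (n : ℕ) (i : Fin n),
      PolygonSpace.edgeMoment (PolygonSpace.armMeasure2 n) i 2 =
        8 / ((n : ℝ) * ((n : ℝ) + 1))) ∧
    (∀ (n : ℕ) (i : Fin n), 2 ≤ n →
      PolygonSpace.edgeMoment (PolygonSpace.polMeasure2 n) i 2 =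
        8 / ((n : ℝ) * ((n : ℝ) + 2))) := by

  have hpos : ∀ {n : ℕ}, Fin n → (0 : ℝ) < n := fun i => by exact_mod_cast i.pos
  refine ⟨fun n i p hp => PolygonSpace.edgeMoment_armMeasure3 i hp,
    fun n i p hn hp => PolygonSpace.edgeMoment_polMeasure3 i hn hp,
    fun n i p hp => PolygonSpace.edgeMoment_armMeasure2 i hp,
    fun n i p hn hp => PolygonSpace.edgeMoment_polMeasure2 i hn hp, ?_, ?_, ?_, ?_⟩
  -- Here `2 ^ 2 * 6 / (2n (2n + 1)) = 6 / (n (n + 1/2))`.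
  · intro n i
    have := hpos i
    rw [PolygonSpace.edgeMoment_armMeasure3 i two_pos, PolygonSpace.beta_two_left (by positivity),
      PolygonSpace.beta_two_left two_pos, Real.rpow_two]
    field_simp
    norm_num
  · intro n i hn
    have := hpos i
    rw [PolygonSpace.edgeMoment_polMeasure3 i hn two_pos, PolygonSpace.beta_two_left this,
      PolygonSpace.beta_two_left two_pos]
    field_simp
    norm_num
  · intro n i
    have := hpos i
    rw [PolygonSpace.edgeMoment_armMeasure2 i two_pos, PolygonSpace.beta_two_left this,
      PolygonSpace.beta_two_left one_pos, Real.rpow_two]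
    field_simp
    norm_num
  · intro n i hn
    have := hpos i
    rw [PolygonSpace.edgeMoment_polMeasure2 i hn two_pos,
      PolygonSpace.beta_two_left (by positivity), PolygonSpace.beta_two_left one_pos]
    field_simp
    norm_num
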